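/- Let $H, G_1,\dots,G_m$ ($m\ge 1$) be finite-dimensional real Hilbert spaces. For a Hilbert space $E$ let $\Gamma_0(E)$ be the set of proper lower semicontinuous convex functions $E\to(-\infty,+\infty]$; for $\varphi\in\Gamma_0(E)$ and $c>0$ let $\operatorname{prox}_{c\varphi}(u)=\arg\min_{x}\{\tfrac12\|x-u\|^2+c\,\varphi(x)\}$, and let $\varphi^*(y)=\sup_x(\langle x,y\rangle-\varphi(x))$ be the Fenchel conjugate. Let $f:H\to\mathbb R$ be convex and differentiable with $L$-Lipschitz continuous gradient, $L>0$; let $g\in\Gamma_0(H)$, $h_i\in\Gamma_0(G_i)$, and let $B_i:H\to G_i$ be linear ($i=1,\dots,m$). Suppose that the problem $$\min_{x\in H}\; f(x)+g(x)+\sum_{i=1}^m h_i(B_ix)\qquad(1.1)$$ has a solution, that is, a minimizer with finite objective value. Put $(h\circ B)(x)=\sum_{i=1}^m h_i(B_ix)$. Let $w_i>0$ with $\sum_{i=1}^m w_i=1$, let $0<\gamma<2/L$ and $0<\lambda<2/\sum_{i=1}^m w_i\|B_i\|^2$ (no upper bound on $\lambda$ if all $B_i=0$), and let $(\varepsilon_k)_{k\ge0}$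 be a summable real sequence. Let $x^0\in H$ and $y^0\in G_1\times\dots\times G_m$ be arbitrary, and let sequences be generated as follows (Algorithm 4.1). For $k=0,1,2,\dots$: 1. (Outer step) $u^k=x^k-\gamma\nabla f(x^k)$. 2. (Inner loop) Start from some $y^{k,0}\in G_1\times\dots\times G_m$, where $y^{0,0}=y^0$ and $y^{k,0}$ for $k\ge1$ is arbitrary (in particular $y^0$ or the last dual iterate of the previous loop is allowed), and for $j=0,1,2,\dots$ and $i=1,\dots,m$ set $$p^{k,j}=\operatorname{prox}_{\gamma g}\Big(u^k-\gamma\sum_{l=1}^m w_lB_l^*y_l^{k,j}\Big),\qquad y_i^{k,j+1}=\frac1{w_i}\operatorname{prox}_{w_i\frac{\lambda}{\gamma}h_i^*}\Big(w_i\big(y_i^{k,j}+\tfrac{\lambda}{\gamma}B_i\,p^{k,j}\big)\Big).$$ 3. (Update) Either the inner loop is carried to its limit, $x^{k+1}=\lim_{j\to\infty}p^{k,j}$, or it is stopped after $J_k+1$ steps for some $J_k\ge 0$ and $x^{k+1}=p^{k,J_k+1}$, where the stopping criterion guarantees $\|x^{k+1}-\operatorname{prox}_{\gamma(g+h\circ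 B)}(u^k)\|\le\varepsilon_k$. Then: (a) for every $k$ the inner loop, if continued indefinitely, computes the proximal point: $p^{k,j}\to\operatorname{prox}_{\gamma(g+h\circ B)}(u^k)$ as $j\to\infty$; (b) the sequence $(x^k)$ converges to a solution of (1.1). -/

import Mathlib

open Filter Topology
open scoped NNReal Gradient InnerProductSpace

noncomputable section

namespace CompositeSplitting

/-- The class `Γ₀(E)` of proper lower semicontinuous convex functions `E → (-∞, +∞]`.
Convexity of an extended-real-valued function is convexity of its epigraph. -/
structure GammaZero {E : Type*} [NormedAddCommGroup E] [InnerProductSpace ℝ E]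
    (φ : E → EReal) : Prop where
  ne_bot : ∀ x, φ x ≠ ⊥
  proper : ∃ x, φ x ≠ ⊤
  lsc : LowerSemicontinuous φ
  convex : Convex ℝ {p : E × ℝ | φ p.1 ≤ (p.2 : EReal)}

/-- The Fenchel conjugate `φ*(y) = sup_x (⟨x, y⟩ - φ x)`. -/
def conjugate {E : Type*} [NormedAddCommGroup E] [InnerProductSpace ℝ E]
    (φ : E → EReal) (y : E) : EReal :=
  ⨆ x : E, ((⟪x, y⟫_ℝ : ℝ) : EReal) - φ x

/-- `p` minimizes `x ↦ ½‖x - u‖² + c φ(x)`. -/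
def IsProxPoint {E : Type*} [NormedAddCommGroup E] [InnerProductSpace ℝ E]
    (c : ℝ) (φ : E → EReal) (u p : E) : Prop :=
  ∀ x : E, ((1 / 2 * ‖p - u‖ ^ 2 : ℝ) : EReal) + (c : EReal) * φ p
    ≤ ((1 / 2 * ‖x - u‖ ^ 2 : ℝ) : EReal) + (c : EReal) * φ x

/-- The proximity operator `prox_{c φ}(u) = argmin_x (½‖x - u‖² + c φ(x))`; the minimizer exists
and is unique for `φ ∈ Γ₀(E)`, `c > 0` and `E` a Hilbert space. -/
def prox {E : Type*} [NormedAddCommGroup E] [InnerProductSpace ℝ E]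
    (c : ℝ) (φ : E → EReal) (u : E) : E :=
  Classical.epsilon (IsProxPoint c φ u)

section Problem

variable {H : Type*} [NormedAddCommGroup H] [InnerProductSpace ℝ H] [CompleteSpace H]
  {m : ℕ} {G : Fin m → Type*} [∀ i, NormedAddCommGroup (G i)]
  [∀ i, InnerProductSpace ℝ (G i)] [∀ i, CompleteSpace (G i)]

/-- The nonsmooth part `x ↦ g(x) + ∑ i, h_i (B_i x)`. -/
def nonsmooth (g : H → EReal) (h : ∀ i, G i → EReal) (B : ∀ i, H →L[ℝ] G i) (x : H) : EReal :=
  g x + ∑ i, h i (B i x)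

/-- The objective `f(x) + g(x) + ∑ i, h_i (B_i x)` of the composite problem. -/
def objective (f : H → ℝ) (g : H → EReal) (h : ∀ i, G i → EReal) (B : ∀ i, H →L[ℝ] G i)
    (x : H) : EReal :=
  (f x : EReal) + nonsmooth g h B x

/-- `x` solves the composite problem: it minimizes the objective, with a finite value
(the value is never `⊥` when `g` and the `h i` lie in `Γ₀`). -/
def IsSolution (f : H → ℝ) (g : H → EReal) (h : ∀ i, G i → EReal) (B : ∀ i, H →L[ℝ] G i)
    (x : H) : Prop :=
  objective f g h B x ≠ ⊤ ∧ ∀ z, objective f g h B x ≤ objective f g h B z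

/-- The primal point `prox_{γ g}(u - γ ∑ i, w_i B_i^* y_i)` attached to a dual point `y`. -/
def primalPoint (g : H → EReal) (B : ∀ i, H →L[ℝ] G i) (w : Fin m → ℝ) (γ : ℝ)
    (u : H) (y : ∀ i, G i) : H :=
  prox γ g (u - γ • ∑ i, w i • (ContinuousLinearMap.adjoint (B i)) (y i))

/-- One step of the inner (dual forward-backward) iteration:
`y_i ↦ (1 / w_i) prox_{(w_i λ / γ) h_i^*}
  (w_i (y_i + (λ / γ) B_i prox_{γ g}(u - γ ∑ l, w_l B_l^* y_l)))`. -/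
def dualStep (g : H → EReal) (h : ∀ i, G i → EReal) (B : ∀ i, H →L[ℝ] G i)
    (w : Fin m → ℝ) (γ lam : ℝ) (u : H) (y : ∀ i, G i) : ∀ i, G i := fun i =>
  (1 / w i) • prox (w i * (lam / γ)) (conjugate (h i))
    (w i • (y i + (lam / γ) • B i (primalPoint g B w γ u y)))

/-- The sequences `x`, `u`, `y` are generated by the algorithm from `x0`, `y0`, with weights `w`,
parameters `γ`, `lam` and inner tolerances `ε`.  Here `y k j` is the `j`-th iterate of the inner
loop of outer iteration `k`.  The starting point `y (k + 1) 0` of a later inner loop is left free,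
so that restarting at `y0` and continuing with the last dual iterate are both covered.
An inner loop is either carried to its limit, or stopped after finitely many (at least one)
steps, at a moment when its primal point is within `ε k` of the point `prox_{γ(g + h ∘ B)}(u k)`
that the loop computes. -/
structure IsGenerated (f : H → ℝ) (g : H → EReal) (h : ∀ i, G i → EReal)
    (B : ∀ i, H →L[ℝ] G i) (w : Fin m → ℝ) (γ lam : ℝ) (ε : ℕ → ℝ)
    (x0 : H) (y0 : ∀ i, G i) (x u : ℕ → H) (y : ℕ → ℕ → ∀ i, G i) : Prop where
  x_init : x 0 = x0
  y_init : y 0 0 = y0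
  outer : ∀ k, u k = x k - γ • ∇ f (x k)
  inner : ∀ k j, y k (j + 1) = dualStep g h B w γ lam (u k) (y k j)
  update : ∀ k,
    Tendsto (fun j => primalPoint g B w γ (u k) (y k j)) atTop (𝓝 (x (k + 1))) ∨
    ∃ J : ℕ, x (k + 1) = primalPoint g B w γ (u k) (y k (J + 1)) ∧
      ‖x (k + 1) - prox γ (nonsmooth g h B) (u k)‖ ≤ ε k

end Problem

end CompositeSplitting

end

noncomputable section

namespace CompositeSplitting

/-! Write `φ = nonsmooth g h B`. For the inner loop, the proximal problem for `φ` at `u` has a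
concave dual, and `dualStep` is a forward-backward step on it in the norm `∑ w_i ‖y_i‖²`. The bound
on `lam` makes the dual values increase. Strong convexity of the primal problem bounds half the
squared distance from the primal point to the proximal point by the gap between primal optimum and
dual value (`norm_sub_primalPoint_sq_le`). It therefore suffices that the dual values tend to the
primal optimum.

No qualification condition is assumed, so the dual supremum need not be attained. Equality of the
two optimal values is enough: `exists_dualValue_gt` obtains it by penalizing the constraint `r_i =
B_i x` and letting the penalty parameter `s` tend to zero. By `le_of_dissipation`, the
forward-backward inequality `dualValue_sub_le` then lifts the limit of the dual values above the
value of every feasible dual point.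

For the outer loop, `T x = prox γ φ (x - γ ∇f x)` is averaged when `γ < 2 / L`, by the
Baillon–Haddad theorem and firm nonexpansiveness, and its fixed points are the solutions. The
iterates follow `T` up to summable errors, so they are quasi-Fejér with respect to the solutions.
Their residuals vanish, and a cluster point, which exists by finite dimensionality, is a fixed point
and hence the limit. -/

/-- Turns minimality along a segment, after division by the step `t`, into a first-order condition;
`b` carries the second-order remainder. -/
theorem nonneg_of_forall_nonneg_add_mul {a b : ℝ}
    (hab : ∀ t : ℝ, 0 < t → t ≤ 1 → 0 ≤ a + t * b) : 0 ≤ a := by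
  have hlim : Tendsto (fun t : ℝ => a + t * b) (𝓝[>] 0) (𝓝 a) := by
    have hc : Continuous fun t : ℝ => a + t * b := by fun_prop
    have := hc.tendsto 0
    simp only [zero_mul, add_zero] at this
    exact this.mono_left nhdsWithin_le_nhds
  refine ge_of_tendsto hlim ?_
  filter_upwards [Ioc_mem_nhdsGT (zero_lt_one : (0 : ℝ) < 1)] with t ht
  exact hab t ht.1 ht.2

/-! ### Functions in `Γ₀` and proximal points -/

section GammaZero

variable {E : Type*} [NormedAddCommGroup E] [InnerProductSpace ℝ E] {φ : E → EReal}

theorem GammaZero.coe_toReal (hφ : GammaZero φ) {x : E} (hx : φ x ≠ ⊤) :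
    ((φ x).toReal : EReal) = φ x :=
  EReal.coe_toReal hx (hφ.ne_bot x)

theorem GammaZero.le_combo (hφ : GammaZero φ) {x y : E} (hx : φ x ≠ ⊤) (hy : φ y ≠ ⊤)
    {a b : ℝ} (ha : 0 ≤ a) (hb : 0 ≤ b) (hab : a + b = 1) :
    φ (a • x + b • y) ≤ ((a * (φ x).toReal + b * (φ y).toReal : ℝ) : EReal) := by
  have hx' : (x, (φ x).toReal) ∈ {p : E × ℝ | φ p.1 ≤ (p.2 : EReal)} := (hφ.coe_toReal hx).ge
  have hy' : (y, (φ y).toReal) ∈ {p : E × ℝ | φ p.1 ≤ (p.2 : EReal)} := (hφ.coe_toReal hy).ge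
  exact hφ.convex hx' hy' ha hb hab

theorem convex_epigraph_of_le_combo (hbot : ∀ x, φ x ≠ ⊥)
    (hφ : ∀ x y, φ x ≠ ⊤ → φ y ≠ ⊤ → ∀ a b : ℝ, 0 ≤ a → 0 ≤ b → a + b = 1 →
      φ (a • x + b • y) ≤ ((a * (φ x).toReal + b * (φ y).toReal : ℝ) : EReal)) :
    Convex ℝ {p : E × ℝ | φ p.1 ≤ (p.2 : EReal)} := by
  rintro ⟨x, s⟩ hx ⟨y, t⟩ hy a b ha hb hab
  simp only [Set.mem_ofPred_eq] at hx hy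
  have hx' : φ x ≠ ⊤ := ne_top_of_le_ne_top (EReal.coe_ne_top s) hx
  have hy' : φ y ≠ ⊤ := ne_top_of_le_ne_top (EReal.coe_ne_top t) hy
  refine (hφ x y hx' hy' a b ha hb hab).trans ?_
  rw [← EReal.coe_toReal hx' (hbot x), EReal.coe_le_coe_iff] at hx
  rw [← EReal.coe_toReal hy' (hbot y), EReal.coe_le_coe_iff] at hy
  simp only [Prod.smul_mk, Prod.mk_add_mk, smul_eq_mul, EReal.coe_le_coe_iff]
  gcongr

/-- Hahn–Banach separates the closed convex epigraph from a point strictly below the graph. -/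
theorem GammaZero.exists_affine_le [CompleteSpace E] (hφ : GammaZero φ) :
    ∃ (a : E) (b : ℝ), ∀ x, ((⟪a, x⟫_ℝ + b : ℝ) : EReal) ≤ φ x := by
  obtain ⟨x₀, hx₀⟩ := hφ.proper
  have hclosed : IsClosed {p : E × ℝ | φ p.1 ≤ (p.2 : EReal)} :=
    hφ.lsc.isClosed_epigraph.preimage
      (continuous_fst.prodMk (continuous_coe_real_ereal.comp continuous_snd))
  have hnot : (x₀, (φ x₀).toReal - 1) ∉ {p : E × ℝ | φ p.1 ≤ (p.2 : EReal)} := by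
    rw [Set.mem_ofPred_eq, ← hφ.coe_toReal hx₀, EReal.coe_le_coe_iff, EReal.toReal_coe]
    linarith
  obtain ⟨F, s, hF₀, hF⟩ := geometric_hahn_banach_point_closed hφ.convex hclosed hnot
  have hsplit : ∀ x t, F (x, t) = F (x, 0) + t * F (0, 1) := by
    intro x t
    have : ((x, t) : E × ℝ) = (x, 0) + t • (0, 1) := by simp
    rw [this, map_add, map_smul, smul_eq_mul]
  have h₁ : ∀ x, φ x ≠ ⊤ → s < F (x, 0) + (φ x).toReal * F (0, 1) := by
    intro x hx
    rw [← hsplit]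
    exact hF _ (hφ.coe_toReal hx).ge
  -- The hyperplane is not vertical: it separates two points on the same vertical line over `x₀`.
  have hpos : 0 < F (0, 1) := by
    have h₂ := h₁ x₀ hx₀
    rw [hsplit] at hF₀
    nlinarith
  refine ⟨-(1 / F (0, 1)) •
    (InnerProductSpace.toDual ℝ E).symm (F.comp (ContinuousLinearMap.inl ℝ E ℝ)),
    s / F (0, 1), fun x => ?_⟩
  by_cases hx : φ x = ⊤
  · rw [hx]; exact le_top
  rw [← hφ.coe_toReal hx, EReal.coe_le_coe_iff, real_inner_smul_left,
    InnerProductSpace.toDual_symm_apply]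
  simp only [ContinuousLinearMap.comp_apply, ContinuousLinearMap.inl_apply]
  have h₂ := h₁ x hx
  have : -(1 / F (0, 1)) * F (x, 0) + s / F (0, 1) = (s - F (x, 0)) / F (0, 1) := by ring
  rw [this, div_le_iff₀ hpos]
  linarith

theorem GammaZero.exists_norm_le [CompleteSpace E] (hφ : GammaZero φ) :
    ∃ C : ℝ, 0 ≤ C ∧ ∀ x, ((-(C * (1 + ‖x‖)) : ℝ) : EReal) ≤ φ x := by
  obtain ⟨a, b, hab⟩ := hφ.exists_affine_le
  refine ⟨‖a‖ + |b|, by positivity, fun x => le_trans ?_ (hab x)⟩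
  rw [EReal.coe_le_coe_iff]
  have h₁ := neg_le_of_abs_le (abs_real_inner_le_norm a x)
  nlinarith [neg_abs_le b, norm_nonneg x, norm_nonneg a, abs_nonneg b,
    mul_nonneg (abs_nonneg b) (norm_nonneg x)]

theorem exists_forall_le_of_sublevel_bounded {X : Type*} [PseudoMetricSpace X] [ProperSpace X]
    {F : X → EReal} (hF : LowerSemicontinuous F) (x₀ u : X) (R : ℝ)
    (hR : ∀ x, F x ≤ F x₀ → dist x u ≤ R) : ∃ p, ∀ x, F p ≤ F x := by
  have hx₀ : x₀ ∈ Metric.closedBall u R := hR x₀ le_rfl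
  obtain ⟨p, -, hp⟩ := LowerSemicontinuousOn.exists_isMinOn ⟨x₀, hx₀⟩
    (isCompact_closedBall u R) (hF.lowerSemicontinuousOn _)
  refine ⟨p, fun x => ?_⟩
  by_cases hx : F x ≤ F x₀
  · exact hp (hR x hx)
  · exact (hp hx₀).trans (not_le.mp hx).le

theorem le_of_sq_le_add_mul {t A K : ℝ} (hA : 0 ≤ A) (hK : 0 ≤ K) (h : t ^ 2 ≤ A + K * t) :
    t ≤ A + K + 1 := by
  by_contra! hc
  nlinarith [mul_nonneg hA hK]

/-- The quadratic term dominates the at most linear decay of `φ`, so sublevel sets are bounded and a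
lower semicontinuous function attains its minimum. -/
theorem GammaZero.exists_isProxPoint [CompleteSpace E] [ProperSpace E] (hφ : GammaZero φ)
    {c : ℝ} (hc : 0 < c) (u : E) :
    ∃ p, φ p ≠ ⊤ ∧ ∀ x, φ x ≠ ⊤ →
      1 / 2 * ‖p - u‖ ^ 2 + c * (φ p).toReal ≤ 1 / 2 * ‖x - u‖ ^ 2 + c * (φ x).toReal := by
  obtain ⟨x₀, hx₀⟩ := hφ.proper
  obtain ⟨C, hC, hCφ⟩ := hφ.exists_norm_le
  -- Dividing by `c` leaves `φ` without a coefficient, so lower semicontinuity involves no product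
  -- in `EReal`.
  set F : E → EReal := fun x => ((1 / (2 * c) * ‖x - u‖ ^ 2 : ℝ) : EReal) + φ x with hFdef
  have hFreal : ∀ x, φ x ≠ ⊤ →
      F x = ((1 / (2 * c) * ‖x - u‖ ^ 2 + (φ x).toReal : ℝ) : EReal) := by
    intro x hx
    rw [EReal.coe_add, hφ.coe_toReal hx]
  have hFtop : ∀ x, φ x = ⊤ → F x = ⊤ := by
    intro x hx
    simp only [hFdef, hx, EReal.coe_add_top]
  have hF : LowerSemicontinuous F := by
    have hcont : Continuous fun x : E => ((1 / (2 * c) * ‖x - u‖ ^ 2 : ℝ) : EReal) :=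
      continuous_coe_real_ereal.comp (by fun_prop)
    exact hcont.lowerSemicontinuous.add' hφ.lsc fun x =>
      EReal.continuousAt_add (Or.inl (EReal.coe_ne_top _)) (Or.inl (EReal.coe_ne_bot _))
  set M : ℝ := 1 / (2 * c) * ‖x₀ - u‖ ^ 2 + (φ x₀).toReal with hM
  obtain ⟨p, hp⟩ := exists_forall_le_of_sublevel_bounded hF x₀ u
    (2 * c * (|M| + C * (1 + ‖u‖)) + 2 * c * C + 1) (by
      intro x hx
      have hxt : φ x ≠ ⊤ := by
        intro h
        rw [hFtop x h, hFreal x₀ hx₀, top_le_iff] at hx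
        exact EReal.coe_ne_top _ hx
      rw [hFreal x hxt, hFreal x₀ hx₀, EReal.coe_le_coe_iff, ← hM] at hx
      have h₁ := hCφ x
      rw [← hφ.coe_toReal hxt, EReal.coe_le_coe_iff] at h₁
      have h₂ : ‖x‖ ≤ ‖x - u‖ + ‖u‖ := by simpa using norm_add_le (x - u) u
      rw [dist_eq_norm]
      refine le_of_sq_le_add_mul (by positivity) (by positivity) ?_
      have h₃ : 1 / (2 * c) * ‖x - u‖ ^ 2 ≤ |M| + C * (1 + ‖u‖) + C * ‖x - u‖ := by
        nlinarith [le_abs_self M, mul_le_mul_of_nonneg_left h₂ hC]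
      have h₄ := mul_le_mul_of_nonneg_left h₃ (by positivity : (0 : ℝ) ≤ 2 * c)
      have h₅ : 2 * c * (1 / (2 * c) * ‖x - u‖ ^ 2) = ‖x - u‖ ^ 2 := by field_simp
      linarith)
  have hpt : φ p ≠ ⊤ := by
    intro h
    have h₁ := hp x₀
    rw [hFtop p h, hFreal x₀ hx₀, top_le_iff] at h₁
    exact EReal.coe_ne_top _ h₁
  refine ⟨p, hpt, fun x hx => ?_⟩
  have h₁ := hp x
  rw [hFreal p hpt, hFreal x hx, EReal.coe_le_coe_iff] at h₁
  have h₂ := mul_le_mul_of_nonneg_left h₁ hc.le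
  have h₃ : ∀ a b : ℝ, c * (1 / (2 * c) * a + b) = 1 / 2 * a + c * b := by
    intro a b; field_simp
  rwa [h₃, h₃] at h₂

theorem GammaZero.isProxPoint_iff (hφ : GammaZero φ) {c : ℝ} (hc : 0 < c) (u p : E) :
    IsProxPoint c φ u p ↔ φ p ≠ ⊤ ∧ ∀ x, φ x ≠ ⊤ →
      1 / 2 * ‖p - u‖ ^ 2 + c * (φ p).toReal ≤ 1 / 2 * ‖x - u‖ ^ 2 + c * (φ x).toReal := by
  have hreal : ∀ x, φ x ≠ ⊤ → ((1 / 2 * ‖x - u‖ ^ 2 : ℝ) : EReal) + (c : EReal) * φ x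
      = ((1 / 2 * ‖x - u‖ ^ 2 + c * (φ x).toReal : ℝ) : EReal) := by
    intro x hx
    rw [EReal.coe_add, EReal.coe_mul c, hφ.coe_toReal hx]
  have htop : ∀ x, φ x = ⊤ → ((1 / 2 * ‖x - u‖ ^ 2 : ℝ) : EReal) + (c : EReal) * φ x = ⊤ := by
    intro x hx
    rw [hx, EReal.coe_mul_top_of_pos hc, EReal.coe_add_top]
  constructor
  · intro h
    obtain ⟨x₀, hx₀⟩ := hφ.proper
    have hp : φ p ≠ ⊤ := by
      intro hp
      have h₁ := h x₀
      rw [htop p hp, hreal x₀ hx₀, top_le_iff] at h₁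
      exact EReal.coe_ne_top _ h₁
    refine ⟨hp, fun x hx => ?_⟩
    have h₁ := h x
    rwa [hreal p hp, hreal x hx, EReal.coe_le_coe_iff] at h₁
  · rintro ⟨hp, h⟩ x
    by_cases hx : φ x = ⊤
    · rw [htop x hx]; exact le_top
    · rw [hreal p hp, hreal x hx, EReal.coe_le_coe_iff]
      exact h x hx

theorem GammaZero.prox_spec [CompleteSpace E] [ProperSpace E] (hφ : GammaZero φ)
    {c : ℝ} (hc : 0 < c) (u : E) :
    φ (prox c φ u) ≠ ⊤ ∧ ∀ x, φ x ≠ ⊤ →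
      1 / 2 * ‖prox c φ u - u‖ ^ 2 + c * (φ (prox c φ u)).toReal
        ≤ 1 / 2 * ‖x - u‖ ^ 2 + c * (φ x).toReal := by
  obtain ⟨p, hp⟩ := hφ.exists_isProxPoint hc u
  rw [← hφ.isProxPoint_iff hc u]
  exact Classical.epsilon_spec ⟨p, (hφ.isProxPoint_iff hc u p).2 hp⟩

theorem GammaZero.prox_ne_top [CompleteSpace E] [ProperSpace E] (hφ : GammaZero φ)
    {c : ℝ} (hc : 0 < c) (u : E) : φ (prox c φ u) ≠ ⊤ :=
  (hφ.prox_spec hc u).1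

/-- The variational inequality that characterizes `prox c φ u`. -/
theorem GammaZero.inner_prox_le [CompleteSpace E] [ProperSpace E] (hφ : GammaZero φ)
    {c : ℝ} (hc : 0 < c) (u : E) {x : E} (hx : φ x ≠ ⊤) :
    ⟪u - prox c φ u, x - prox c φ u⟫_ℝ ≤ c * ((φ x).toReal - (φ (prox c φ u)).toReal) := by
  obtain ⟨hp, hmin⟩ := hφ.prox_spec hc u
  set p := prox c φ u
  rw [← sub_nonneg]
  -- Minimality of `p` is tested at `p + t (x - p)`, then divided by `t`.
  refine nonneg_of_forall_nonneg_add_mul (b := 1 / 2 * ‖x - p‖ ^ 2) fun t ht ht1 => ?_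
  have hcombo := hφ.le_combo hp hx (sub_nonneg.2 ht1) ht.le (by ring)
  have hpt : (1 - t) • p + t • x = p + t • (x - p) := by module
  rw [hpt] at hcombo
  have hfin : φ (p + t • (x - p)) ≠ ⊤ := ne_top_of_le_ne_top (EReal.coe_ne_top _) hcombo
  rw [← hφ.coe_toReal hfin, EReal.coe_le_coe_iff] at hcombo
  have h₁ := hmin _ hfin
  have h₂ : ‖p + t • (x - p) - u‖ ^ 2
      = ‖p - u‖ ^ 2 - 2 * t * ⟪u - p, x - p⟫_ℝ + t ^ 2 * ‖x - p‖ ^ 2 := by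
    have : p + t • (x - p) - u = t • (x - p) - (u - p) := by module
    rw [this, norm_sub_sq_real, norm_smul, real_inner_smul_left, real_inner_comm,
      norm_sub_rev u p, mul_pow, Real.norm_eq_abs, sq_abs]
    ring
  rw [h₂] at h₁
  have h₃ := mul_le_mul_of_nonneg_left hcombo hc.le
  refine nonneg_of_mul_nonneg_right (a := t) ?_ ht
  nlinarith

/-- Adding the variational inequalities at `p` and at the chosen minimizer bounds their squared
distance by zero. This identifies the value selected by `Classical.epsilon`. -/
theorem GammaZero.prox_eq [CompleteSpace E] [ProperSpace E] (hφ : GammaZero φ)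
    {c : ℝ} (hc : 0 < c) {u p : E} (hp : φ p ≠ ⊤)
    (h : ∀ x, φ x ≠ ⊤ → ⟪u - p, x - p⟫_ℝ ≤ c * ((φ x).toReal - (φ p).toReal)) :
    prox c φ u = p := by
  have h₁ := h _ (hφ.prox_ne_top hc u)
  have h₂ := hφ.inner_prox_le hc u hp
  set q := prox c φ u
  have h₃ : ⟪q - p, q - p⟫_ℝ = ⟪u - p, q - p⟫_ℝ + ⟪u - q, p - q⟫_ℝ := by
    rw [← neg_sub q p, inner_neg_right, ← sub_eq_add_neg, ← inner_sub_left]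
    congr 1
    abel
  rw [← sub_eq_zero, ← norm_eq_zero, ← sq_eq_zero_iff]
  refine le_antisymm ?_ (sq_nonneg _)
  rw [← real_inner_self_eq_norm_sq, h₃]
  linarith

/-- The proximity operator is firmly nonexpansive. -/
theorem GammaZero.norm_prox_sub_prox_sq_le [CompleteSpace E] [ProperSpace E] (hφ : GammaZero φ)
    {c : ℝ} (hc : 0 < c) (u v : E) :
    ‖prox c φ u - prox c φ v‖ ^ 2 + ‖(u - v) - (prox c φ u - prox c φ v)‖ ^ 2
      ≤ ‖u - v‖ ^ 2 := by
  have h₁ := hφ.inner_prox_le hc u (hφ.prox_ne_top hc v)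
  have h₂ := hφ.inner_prox_le hc v (hφ.prox_ne_top hc u)
  set p := prox c φ u
  set q := prox c φ v
  have h₃ : ⟪p - q, p - q⟫_ℝ - ⟪u - v, p - q⟫_ℝ = ⟪u - p, q - p⟫_ℝ + ⟪v - q, p - q⟫_ℝ := by
    rw [← neg_sub p q, inner_neg_right, ← inner_sub_left, neg_add_eq_sub, ← inner_sub_left]
    congr 1
    abel
  rw [real_inner_self_eq_norm_sq] at h₃
  rw [norm_sub_sq_real (u - v)]
  linarith

/-- The proximal objective grows quadratically around the proximal point. -/
theorem GammaZero.prox_growth [CompleteSpace E] [ProperSpace E] (hφ : GammaZero φ)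
    {c : ℝ} (hc : 0 < c) (u : E) {x : E} (hx : φ x ≠ ⊤) :
    1 / 2 * ‖prox c φ u - u‖ ^ 2 + c * (φ (prox c φ u)).toReal + 1 / 2 * ‖x - prox c φ u‖ ^ 2
      ≤ 1 / 2 * ‖x - u‖ ^ 2 + c * (φ x).toReal := by
  have h₁ := hφ.inner_prox_le hc u hx
  set p := prox c φ u
  have h₂ : ‖x - u‖ ^ 2 = ‖x - p‖ ^ 2 - 2 * ⟪u - p, x - p⟫_ℝ + ‖p - u‖ ^ 2 := by
    have : x - u = (x - p) - (u - p) := by abel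
    rw [this, norm_sub_sq_real, real_inner_comm, norm_sub_rev u p]
  rw [h₂]
  linarith

theorem GammaZero.continuous_prox [CompleteSpace E] [ProperSpace E] (hφ : GammaZero φ)
    {c : ℝ} (hc : 0 < c) : Continuous (prox c φ) := by
  refine (LipschitzWith.of_dist_le_mul (K := 1) fun u v => ?_).continuous
  rw [dist_eq_norm, dist_eq_norm, NNReal.coe_one, one_mul]
  have h₁ := hφ.norm_prox_sub_prox_sq_le hc u v
  exact le_of_sq_le_sq (by nlinarith [sq_nonneg ‖(u - v) - (prox c φ u - prox c φ v)‖])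
    (norm_nonneg _)

/-! ### Stability of `Γ₀` -/

theorem GammaZero.add {ψ : E → EReal} (hφ : GammaZero φ) (hψ : GammaZero ψ)
    (hdom : ∃ x, φ x + ψ x ≠ ⊤) : GammaZero fun x => φ x + ψ x where
  ne_bot x := by simp [EReal.add_eq_bot_iff, hφ.ne_bot x, hψ.ne_bot x]
  proper := hdom
  lsc := hφ.lsc.add' hψ.lsc fun x =>
    EReal.continuousAt_add (Or.inr (hψ.ne_bot x)) (Or.inl (hφ.ne_bot x))
  convex := by
    refine convex_epigraph_of_le_combo (φ := fun x => φ x + ψ x)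
      (fun x => by simp [EReal.add_eq_bot_iff, hφ.ne_bot x, hψ.ne_bot x])
      fun x y hx hy a b ha hb hab => ?_
    rw [EReal.add_ne_top_iff_ne_top₂ (hφ.ne_bot _) (hψ.ne_bot _)] at hx hy
    refine (add_le_add (hφ.le_combo hx.1 hy.1 ha hb hab)
      (hψ.le_combo hx.2 hy.2 ha hb hab)).trans ?_
    rw [EReal.toReal_add hx.1 (hφ.ne_bot _) hx.2 (hψ.ne_bot _),
      EReal.toReal_add hy.1 (hφ.ne_bot _) hy.2 (hψ.ne_bot _), ← EReal.coe_add,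
      EReal.coe_le_coe_iff]
    exact le_of_eq (by ring)

theorem GammaZero.comp {E' : Type*} [NormedAddCommGroup E'] [InnerProductSpace ℝ E']
    (hφ : GammaZero φ) (A : E' →L[ℝ] E) (hdom : ∃ x, φ (A x) ≠ ⊤) :
    GammaZero fun x => φ (A x) where
  ne_bot x := hφ.ne_bot _
  proper := hdom
  lsc := hφ.lsc.comp A.continuous
  convex := by
    refine convex_epigraph_of_le_combo (fun x => hφ.ne_bot _) fun x y hx hy a b ha hb hab => ?_
    rw [map_add, map_smul, map_smul]
    exact hφ.le_combo hx hy ha hb hab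

/-- A conjugate is a supremum of affine functions. A point of the domain of `φ` keeps it above `⊥`;
the slope of an affine minorant is a point where it is finite. -/
theorem GammaZero.conjugate [CompleteSpace E] (hφ : GammaZero φ) :
    GammaZero (CompositeSplitting.conjugate φ) where
  ne_bot y := by
    obtain ⟨x₀, hx₀⟩ := hφ.proper
    refine ne_bot_of_le_ne_bot ?_ (le_iSup (fun x => ((⟪x, y⟫_ℝ : ℝ) : EReal) - φ x) x₀)
    rw [← hφ.coe_toReal hx₀, ← EReal.coe_sub]
    exact EReal.coe_ne_bot _
  proper := by
    obtain ⟨a, b, hab⟩ := hφ.exists_affine_le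
    refine ⟨a, ne_top_of_le_ne_top (EReal.coe_ne_top (-b)) (iSup_le fun x => ?_)⟩
    refine (EReal.sub_le_sub le_rfl (hab x)).trans ?_
    rw [← EReal.coe_sub, EReal.coe_le_coe_iff, real_inner_comm]
    linarith
  lsc := by
    refine lowerSemicontinuous_iSup fun x => ?_
    by_cases hx : φ x = ⊤
    · simp only [hx, EReal.sub_top]
      exact lowerSemicontinuous_const
    · rw [← hφ.coe_toReal hx]
      simp only [← EReal.coe_sub]
      exact (continuous_coe_real_ereal.comp (by fun_prop)).lowerSemicontinuous
  convex := by
    rintro ⟨y, s⟩ hy ⟨z, t⟩ hz a b ha hb hab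
    simp only [Set.mem_ofPred_eq, CompositeSplitting.conjugate, iSup_le_iff, Prod.smul_mk,
      Prod.mk_add_mk, smul_eq_mul] at hy hz ⊢
    intro x
    by_cases hx : φ x = ⊤
    · simp [hx]
    have hy := hy x
    have hz := hz x
    rw [← hφ.coe_toReal hx, ← EReal.coe_sub, EReal.coe_le_coe_iff] at hy hz ⊢
    rw [inner_add_right, real_inner_smul_right, real_inner_smul_right]
    have h₁ := mul_le_mul_of_nonneg_left hy ha
    have h₂ := mul_le_mul_of_nonneg_left hz hb
    have h₃ : (φ x).toReal = a * (φ x).toReal + b * (φ x).toReal := by rw [← add_mul, hab, one_mul]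
    linarith

/-- The Fenchel–Young inequality. -/
theorem GammaZero.inner_le_add_conjugate [CompleteSpace E] (hφ : GammaZero φ) {x y : E}
    (hx : φ x ≠ ⊤) (hy : CompositeSplitting.conjugate φ y ≠ ⊤) :
    ⟪x, y⟫_ℝ ≤ (φ x).toReal + (CompositeSplitting.conjugate φ y).toReal := by
  have h₁ : ((⟪x, y⟫_ℝ : ℝ) : EReal) - φ x ≤ CompositeSplitting.conjugate φ y :=
    le_iSup (fun x => ((⟪x, y⟫_ℝ : ℝ) : EReal) - φ x) x
  rw [← hφ.coe_toReal hx, ← hφ.conjugate.coe_toReal hy, ← EReal.coe_sub,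
    EReal.coe_le_coe_iff] at h₁
  linarith

theorem GammaZero.conjugate_le [CompleteSpace E] (hφ : GammaZero φ) {y : E} {M : ℝ}
    (h : ∀ x, φ x ≠ ⊤ → ⟪x, y⟫_ℝ - (φ x).toReal ≤ M) :
    CompositeSplitting.conjugate φ y ≠ ⊤ ∧ (CompositeSplitting.conjugate φ y).toReal ≤ M := by
  have h₁ : CompositeSplitting.conjugate φ y ≤ (M : EReal) := by
    refine iSup_le fun x => ?_
    by_cases hx : φ x = ⊤
    · simp [hx]
    · rw [← hφ.coe_toReal hx, ← EReal.coe_sub, EReal.coe_le_coe_iff]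
      exact h x hx
  have h₂ : CompositeSplitting.conjugate φ y ≠ ⊤ := ne_top_of_le_ne_top (EReal.coe_ne_top M) h₁
  rw [← hφ.conjugate.coe_toReal h₂, EReal.coe_le_coe_iff] at h₁
  exact ⟨h₂, h₁⟩

end GammaZero

/-! ### Convex functions with Lipschitz gradient -/

section Smooth

variable {H : Type*} [NormedAddCommGroup H] [InnerProductSpace ℝ H] [CompleteSpace H]

/-- Along the segment, `f` minus its quadratic upper model has nonpositive derivative. -/
theorem le_add_inner_add_sq_of_lipschitz {f : H → ℝ} {F : H → H} {L : ℝ≥0}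
    (hf : ∀ x, HasGradientAt f (F x) x) (hF : LipschitzWith L F) (x d : H) :
    f (x + d) ≤ f x + ⟪F x, d⟫_ℝ + L / 2 * ‖d‖ ^ 2 := by
  have hderiv : ∀ t : ℝ, HasDerivAt
      (fun t : ℝ => f (x + t • d) - (t * ⟪F x, d⟫_ℝ + t ^ 2 * (L / 2 * ‖d‖ ^ 2)))
      (⟪F (x + t • d), d⟫_ℝ - (1 * ⟪F x, d⟫_ℝ + (2 * t) * (L / 2 * ‖d‖ ^ 2))) t := by
    intro t
    have h₁ : HasDerivAt (fun t : ℝ => x + t • d) d t := by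
      simpa using ((hasDerivAt_id t).smul_const d).const_add x
    have h₂ := (hf (x + t • d)).hasFDerivAt.comp_hasDerivAt t h₁
    have h₃ : HasDerivAt (fun t : ℝ => t ^ 2) (2 * t) t := by
      simpa using hasDerivAt_pow 2 t
    exact h₂.sub (((hasDerivAt_id t).mul_const _).add (h₃.mul_const _))
  have hanti : AntitoneOn
      (fun t : ℝ => f (x + t • d) - (t * ⟪F x, d⟫_ℝ + t ^ 2 * (L / 2 * ‖d‖ ^ 2)))
      (Set.Icc 0 1) := by
    refine antitoneOn_of_deriv_nonpos (convex_Icc 0 1)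
      (fun t _ => (hderiv t).continuousAt.continuousWithinAt)
      (fun t _ => (hderiv t).differentiableAt.differentiableWithinAt) fun t ht => ?_
    rw [interior_Icc] at ht
    rw [(hderiv t).deriv]
    have h₁ := real_inner_le_norm (F (x + t • d) - F x) d
    have h₂ := hF.dist_le_mul (x + t • d) x
    rw [dist_eq_norm, dist_eq_norm, add_sub_cancel_left, norm_smul, Real.norm_eq_abs,
      abs_of_pos ht.1] at h₂
    rw [inner_sub_left] at h₁
    nlinarith [mul_le_mul_of_nonneg_right h₂ (norm_nonneg d)]
  have := hanti (Set.left_mem_Icc.2 zero_le_one) (Set.right_mem_Icc.2 zero_le_one) zero_le_one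
  simp only [one_smul, zero_smul, add_zero] at this
  linarith

theorem add_inner_le_of_convexOn {f : H → ℝ} {F : H → H} {L : ℝ≥0}
    (hconv : ConvexOn ℝ Set.univ f) (hf : ∀ x, HasGradientAt f (F x) x)
    (hF : LipschitzWith L F) (x d : H) : f x + ⟪F x, d⟫_ℝ ≤ f (x + d) := by
  rw [← sub_nonneg]
  refine nonneg_of_forall_nonneg_add_mul (b := L / 2 * ‖d‖ ^ 2) fun t ht ht1 => ?_
  -- The quadratic bound for `-f` is a lower bound for `f (x + t d)`; convexity supplies the upper
  -- one.
  have hneg : ∀ x, HasGradientAt (fun x => -f x) (-F x) x := by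
    intro x
    have := (hf x).hasFDerivAt.neg
    rw [← map_neg] at this
    exact this
  have h₁ := le_add_inner_add_sq_of_lipschitz hneg hF.neg x (t • d)
  have h₂ := hconv.2 (Set.mem_univ x) (Set.mem_univ (x + d)) (sub_nonneg.2 ht1) ht.le (by ring)
  have h₃ : (1 - t) • x + t • (x + d) = x + t • d := by module
  rw [h₃, smul_eq_mul, smul_eq_mul] at h₂
  rw [inner_neg_left, real_inner_smul_right, norm_smul, Real.norm_eq_abs, mul_pow, sq_abs] at h₁
  refine nonneg_of_mul_nonneg_right (a := t) ?_ ht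
  nlinarith

/-- The Baillon–Haddad theorem. -/
theorem norm_sub_sq_le_mul_inner_of_convexOn {f : H → ℝ} {F : H → H} {L : ℝ≥0} (hL : 0 < L)
    (hconv : ConvexOn ℝ Set.univ f) (hf : ∀ x, HasGradientAt f (F x) x)
    (hF : LipschitzWith L F) (x y : H) :
    ‖F x - F y‖ ^ 2 ≤ L * ⟪F x - F y, x - y⟫_ℝ := by
  have hL' : (0 : ℝ) < L := hL
  -- Both bounds are evaluated at the gradient step `y - δ / L`: the tangent plane at `x` from
  -- below, the quadratic model at `y` from above. Adding `key x y` and `key y x` gives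
  -- cocoercivity.
  have key : ∀ x y, f x + ⟪F x, y - x⟫_ℝ + 1 / (2 * L) * ‖F y - F x‖ ^ 2 ≤ f y := by
    intro x y
    set δ := F y - F x with hδ
    have h₁ := add_inner_le_of_convexOn hconv hf hF x (y - x - (1 / (L : ℝ)) • δ)
    have h₂ := le_add_inner_add_sq_of_lipschitz hf hF y (-((1 / (L : ℝ)) • δ))
    have h₃ : x + (y - x - (1 / (L : ℝ)) • δ) = y + -((1 / (L : ℝ)) • δ) := by abel
    rw [h₃, inner_sub_right, real_inner_smul_right] at h₁
    rw [inner_neg_right, norm_neg, norm_smul, real_inner_smul_right, Real.norm_eq_abs, mul_pow,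
      sq_abs] at h₂
    have h₄ : ⟪F y, δ⟫_ℝ = ⟪F x, δ⟫_ℝ + ‖δ‖ ^ 2 := by
      rw [← real_inner_self_eq_norm_sq, ← inner_add_left]
      congr 1
      rw [hδ]; abel
    rw [h₄] at h₂
    have h₅ : (L : ℝ) / 2 * ((1 / (L : ℝ)) ^ 2 * ‖δ‖ ^ 2) = 1 / (2 * L) * ‖δ‖ ^ 2 := by
      field_simp
    have h₆ : 1 / (L : ℝ) * (⟪F x, δ⟫_ℝ + ‖δ‖ ^ 2)
        = 1 / (L : ℝ) * ⟪F x, δ⟫_ℝ + 2 * (1 / (2 * L) * ‖δ‖ ^ 2) := by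
      field_simp
    linarith
  have h₁ := key x y
  have h₂ := key y x
  have h₃ : ⟪F x - F y, x - y⟫_ℝ = -⟪F x, y - x⟫_ℝ - ⟪F y, x - y⟫_ℝ := by
    rw [inner_sub_left, ← neg_sub y x, inner_neg_right, inner_neg_right]
  rw [norm_sub_rev] at h₁
  have h₄ : 1 / (L : ℝ) * ‖F x - F y‖ ^ 2 ≤ ⟪F x - F y, x - y⟫_ℝ := by
    have : 1 / (L : ℝ) * ‖F x - F y‖ ^ 2 = 2 * (1 / (2 * L) * ‖F x - F y‖ ^ 2) := by field_simp
    linarith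
  have h₅ := mul_le_mul_of_nonneg_left h₄ hL'.le
  rwa [← mul_assoc, mul_one_div_cancel hL'.ne', one_mul] at h₅

end Smooth

end CompositeSplitting

namespace CompositeSplitting

/-! ### The nonsmooth part as a function in `Γ₀` -/

section Nonsmooth

theorem sum_ne_bot {ι : Type*} {s : Finset ι} {a : ι → EReal} (ha : ∀ i, a i ≠ ⊥) :
    ∑ i ∈ s, a i ≠ ⊥ := by
  classical
  induction s using Finset.induction_on with
  | empty => simp
  | insert i s hi ih =>
    rw [Finset.sum_insert hi]
    simp [EReal.add_eq_bot_iff, ha i, ih]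

theorem sum_ne_top_iff {ι : Type*} {s : Finset ι} {a : ι → EReal} (ha : ∀ i, a i ≠ ⊥) :
    ∑ i ∈ s, a i ≠ ⊤ ↔ ∀ i ∈ s, a i ≠ ⊤ := by
  classical
  induction s using Finset.induction_on with
  | empty => simp
  | insert i s hi ih =>
    rw [Finset.sum_insert hi, EReal.add_ne_top_iff_ne_top₂ (ha i) (sum_ne_bot ha), ih,
      Finset.forall_mem_insert]

theorem toReal_sum {ι : Type*} {s : Finset ι} {a : ι → EReal} (ha : ∀ i, a i ≠ ⊥)
    (ht : ∀ i ∈ s, a i ≠ ⊤) : (∑ i ∈ s, a i).toReal = ∑ i ∈ s, (a i).toReal := by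
  classical
  induction s using Finset.induction_on with
  | empty => simp
  | insert i s hi ih =>
    rw [Finset.forall_mem_insert] at ht
    rw [Finset.sum_insert hi, Finset.sum_insert hi,
      EReal.toReal_add ht.1 (ha i) ((sum_ne_top_iff ha).2 ht.2) (sum_ne_bot ha), ih ht.2]

variable {H : Type*} [NormedAddCommGroup H] [InnerProductSpace ℝ H]
  {m : ℕ} {G : Fin m → Type*} [∀ i, NormedAddCommGroup (G i)]
  [∀ i, InnerProductSpace ℝ (G i)]
  {g : H → EReal} {h : ∀ i, G i → EReal} (B : ∀ i, H →L[ℝ] G i)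

theorem nonsmooth_ne_top_iff (hg : GammaZero g) (hh : ∀ i, GammaZero (h i)) {x : H} :
    nonsmooth g h B x ≠ ⊤ ↔ g x ≠ ⊤ ∧ ∀ i, h i (B i x) ≠ ⊤ := by
  have hb : ∀ i, h i (B i x) ≠ ⊥ := fun i => (hh i).ne_bot _
  rw [nonsmooth, EReal.add_ne_top_iff_ne_top₂ (hg.ne_bot x) (sum_ne_bot hb), sum_ne_top_iff hb]
  simp

theorem toReal_nonsmooth (hg : GammaZero g) (hh : ∀ i, GammaZero (h i)) {x : H}
    (hgx : g x ≠ ⊤) (hhx : ∀ i, h i (B i x) ≠ ⊤) :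
    (nonsmooth g h B x).toReal = (g x).toReal + ∑ i, (h i (B i x)).toReal := by
  have hb : ∀ i, h i (B i x) ≠ ⊥ := fun i => (hh i).ne_bot _
  have ht : ∀ i ∈ Finset.univ, h i (B i x) ≠ ⊤ := fun i _ => hhx i
  rw [nonsmooth, EReal.toReal_add hgx (hg.ne_bot x) ((sum_ne_top_iff hb).2 ht) (sum_ne_bot hb),
    toReal_sum hb ht]

theorem gammaZero_nonsmooth (hg : GammaZero g) (hh : ∀ i, GammaZero (h i))
    (hdom : ∃ x, nonsmooth g h B x ≠ ⊤) : GammaZero (nonsmooth g h B) := by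
  obtain ⟨x₀, hx₀⟩ := hdom
  obtain ⟨hgx, hhx⟩ := (nonsmooth_ne_top_iff B hg hh).1 hx₀
  have hb : ∀ i, h i (B i x₀) ≠ ⊥ := fun i => (hh i).ne_bot _
  have hsum : ∀ s : Finset (Fin m), GammaZero fun x => ∑ i ∈ s, h i (B i x) := by
    intro s
    induction s using Finset.induction_on with
    | empty =>
      simp only [Finset.sum_empty]
      exact ⟨by simp, ⟨x₀, by simp⟩, lowerSemicontinuous_const,
        convex_epigraph_of_le_combo (φ := fun _ : H => (0 : EReal)) (by simp) (by simp)⟩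
    | insert i s hi ih =>
      simp only [Finset.sum_insert hi]
      refine ((hh i).comp (B i) ⟨x₀, hhx i⟩).add ih ⟨x₀, ?_⟩
      rw [EReal.add_ne_top_iff_ne_top₂ (hb i) (sum_ne_bot hb), sum_ne_top_iff hb]
      exact ⟨hhx i, fun j _ => hhx j⟩
  exact hg.add (hsum Finset.univ) ⟨x₀, hx₀⟩

end Nonsmooth

/-! ### The dual problem of the inner loop -/

/-- The squared norm `y ↦ ∑ i, w_i ‖y_i‖²`. -/
def weightedNormSq {m : ℕ} {G : Fin m → Type*} [∀ i, NormedAddCommGroup (G i)] (w : Fin m → ℝ)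
    (y : ∀ i, G i) : ℝ :=
  ∑ i, w i * ‖y i‖ ^ 2

theorem weightedNormSq_nonneg {m : ℕ} {G : Fin m → Type*} [∀ i, NormedAddCommGroup (G i)]
    {w : Fin m → ℝ} (hw : ∀ i, 0 < w i) (y : ∀ i, G i) : 0 ≤ weightedNormSq w y :=
  Finset.sum_nonneg fun i _ => mul_nonneg (hw i).le (sq_nonneg _)

section Dual

variable {H : Type*} [NormedAddCommGroup H] [InnerProductSpace ℝ H] [CompleteSpace H]
  {m : ℕ} {G : Fin m → Type*} [∀ i, NormedAddCommGroup (G i)]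
  [∀ i, InnerProductSpace ℝ (G i)] [∀ i, CompleteSpace (G i)]

/-- The weighted adjoint `y ↦ ∑ i, w_i B_i^* y_i`. -/
def weightedAdjoint (B : ∀ i, H →L[ℝ] G i) (w : Fin m → ℝ) (y : ∀ i, G i) : H :=
  ∑ i, w i • (ContinuousLinearMap.adjoint (B i)) (y i)

/-- The dual point `y` lies in the domain of the dual objective. -/
def DualFeasible (h : ∀ i, G i → EReal) (w : Fin m → ℝ) (y : ∀ i, G i) : Prop :=
  ∀ i, conjugate (h i) (w i • y i) ≠ ⊤

/-- The smooth part of the dual objective: the minimum over `x` of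
`½‖x - u‖² + γ g(x) + γ ∑ i, w_i ⟨B_i x, y_i⟩`. -/
def dualSmooth (g : H → EReal) (B : ∀ i, H →L[ℝ] G i) (w : Fin m → ℝ) (γ : ℝ) (u : H)
    (y : ∀ i, G i) : ℝ :=
  1 / 2 * ‖primalPoint g B w γ u y - u‖ ^ 2 + γ * (g (primalPoint g B w γ u y)).toReal
    + γ * ⟪primalPoint g B w γ u y, weightedAdjoint B w y⟫_ℝ

/-- The (concave) dual objective of the inner loop. -/
def dualValue (g : H → EReal) (h : ∀ i, G i → EReal) (B : ∀ i, H →L[ℝ] G i) (w : Fin m → ℝ)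
    (γ : ℝ) (u : H) (y : ∀ i, G i) : ℝ :=
  dualSmooth g B w γ u y - γ * ∑ i, (conjugate (h i) (w i • y i)).toReal

variable {g : H → EReal} {h : ∀ i, G i → EReal} {B : ∀ i, H →L[ℝ] G i} {w : Fin m → ℝ}
  {γ lam : ℝ} {u : H}

theorem inner_weightedAdjoint (x : H) (y : ∀ i, G i) :
    ⟪x, weightedAdjoint B w y⟫_ℝ = ∑ i, w i * ⟪B i x, y i⟫_ℝ := by
  rw [weightedAdjoint, inner_sum]
  exact Finset.sum_congr rfl fun i _ => by
    rw [real_inner_smul_right, ContinuousLinearMap.adjoint_inner_right]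

theorem weightedAdjoint_sub (y z : ∀ i, G i) :
    weightedAdjoint B w (y - z) = weightedAdjoint B w y - weightedAdjoint B w z := by
  simp only [weightedAdjoint, Pi.sub_apply, map_sub, smul_sub, Finset.sum_sub_distrib]

/-- Cauchy–Schwarz after splitting `w_i = √w_i √w_i`. The constant is the one that limits `lam`. -/
theorem norm_weightedAdjoint_sq_le (hw : ∀ i, 0 < w i) (y : ∀ i, G i) :
    ‖weightedAdjoint B w y‖ ^ 2 ≤ (∑ i, w i * ‖B i‖ ^ 2) * weightedNormSq w y := by
  have h₁ : ‖weightedAdjoint B w y‖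
      ≤ ∑ i, (Real.sqrt (w i) * ‖B i‖) * (Real.sqrt (w i) * ‖y i‖) := by
    refine (norm_sum_le _ _).trans (Finset.sum_le_sum fun i _ => ?_)
    rw [norm_smul, Real.norm_eq_abs, abs_of_pos (hw i)]
    have h₂ := (ContinuousLinearMap.adjoint (B i)).le_opNorm (y i)
    rw [LinearIsometryEquiv.norm_map] at h₂
    calc w i * ‖(ContinuousLinearMap.adjoint (B i)) (y i)‖ ≤ w i * (‖B i‖ * ‖y i‖) :=
          mul_le_mul_of_nonneg_left h₂ (hw i).le
      _ = (Real.sqrt (w i) * Real.sqrt (w i)) * (‖B i‖ * ‖y i‖) := by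
          rw [Real.mul_self_sqrt (hw i).le]
      _ = _ := by ring
  have h₃ := Finset.sum_mul_sq_le_sq_mul_sq Finset.univ
    (fun i => Real.sqrt (w i) * ‖B i‖) (fun i => Real.sqrt (w i) * ‖y i‖)
  simp only [mul_pow, Real.sq_sqrt (hw _).le] at h₃
  exact (pow_le_pow_left₀ (norm_nonneg _) h₁ 2).trans h₃

theorem smul_dualStep (hw : ∀ i, 0 < w i) (y : ∀ i, G i) (i : Fin m) :
    w i • dualStep g h B w γ lam u y i = prox (w i * (lam / γ)) (conjugate (h i))
      (w i • (y i + (lam / γ) • B i (primalPoint g B w γ u y))) := by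
  rw [dualStep, smul_smul, mul_one_div_cancel (hw i).ne', one_smul]

section DualStep

variable [∀ i, ProperSpace (G i)]

theorem dualFeasible_dualStep (hh : ∀ i, GammaZero (h i)) (hγ : 0 < γ) (hlam : 0 < lam)
    (hw : ∀ i, 0 < w i) (y : ∀ i, G i) : DualFeasible h w (dualStep g h B w γ lam u y) := by
  intro i
  rw [smul_dualStep hw]
  exact (hh i).conjugate.prox_ne_top (mul_pos (hw i) (div_pos hlam hγ)) _

/-- Sum of the variational inequalities of the `m` proximal steps. One factor `w_i` cancels in each
and the other remains, which is why the weighted norm appears; the squares come from the three-point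
identity. -/
theorem dualStep_inequality (hh : ∀ i, GammaZero (h i)) (hγ : 0 < γ) (hlam : 0 < lam)
    (hw : ∀ i, 0 < w i) (y : ∀ i, G i) {z : ∀ i, G i} (hz : DualFeasible h w z) :
    1 / 2 * (weightedNormSq w (dualStep g h B w γ lam u y - y)
        + weightedNormSq w (dualStep g h B w γ lam u y - z) - weightedNormSq w (y - z))
      + lam / γ * ⟪primalPoint g B w γ u y,
          weightedAdjoint B w z - weightedAdjoint B w (dualStep g h B w γ lam u y)⟫_ℝ
      ≤ lam / γ * (∑ i, (conjugate (h i) (w i • z i)).toReal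
        - ∑ i, (conjugate (h i) (w i • dualStep g h B w γ lam u y i)).toReal) := by
  have hσ : 0 < lam / γ := div_pos hlam hγ
  set σ := lam / γ
  set y' := dualStep g h B w γ lam u y with hy'
  set p := primalPoint g B w γ u y
  have h₁ : ∀ i, w i * (1 / 2 * (‖y' i - y i‖ ^ 2 + ‖y' i - z i‖ ^ 2 - ‖y i - z i‖ ^ 2)
      + σ * ⟪B i p, z i - y' i⟫_ℝ) ≤ σ * ((conjugate (h i) (w i • z i)).toReal
        - (conjugate (h i) (w i • y' i)).toReal) := by
    intro i
    have h₂ := (hh i).conjugate.inner_prox_le (mul_pos (hw i) hσ)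
      (w i • (y i + σ • B i p)) (hz i)
    rw [← smul_dualStep hw, ← hy', ← smul_sub, ← smul_sub, real_inner_smul_left,
      real_inner_smul_right, mul_assoc (w i) σ] at h₂
    have h₃ := le_of_mul_le_mul_left h₂ (hw i)
    refine le_trans (le_of_eq ?_) h₃
    congr 1
    have h₄ : y i + σ • B i p - y' i = (y i - y' i) + σ • B i p := by abel
    have h₅ : y i - z i = (y i - y' i) - (z i - y' i) := by abel
    rw [h₄, inner_add_left, real_inner_smul_left, norm_sub_rev (y' i) (y i),
      norm_sub_rev (y' i) (z i), h₅, norm_sub_sq_real (y i - y' i)]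
    ring
  have h₂ := Finset.sum_le_sum fun i (_ : i ∈ Finset.univ) => h₁ i
  rw [← Finset.mul_sum, Finset.sum_sub_distrib] at h₂
  refine le_trans (le_of_eq ?_) h₂
  rw [← weightedAdjoint_sub, inner_weightedAdjoint]
  simp only [weightedNormSq, Pi.sub_apply]
  rw [← Finset.sum_add_distrib, ← Finset.sum_sub_distrib, Finset.mul_sum, Finset.mul_sum,
    ← Finset.sum_add_distrib]
  exact Finset.sum_congr rfl fun i _ => by ring

end DualStep

variable [ProperSpace H]

theorem primalPoint_ne_top (hg : GammaZero g) (hγ : 0 < γ) (y : ∀ i, G i) :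
    g (primalPoint g B w γ u y) ≠ ⊤ :=
  hg.prox_ne_top hγ _

/-- The Lagrangian grows quadratically around the primal point. -/
theorem dualSmooth_add_le (hg : GammaZero g) (hγ : 0 < γ) (y : ∀ i, G i) {x : H}
    (hx : g x ≠ ⊤) :
    dualSmooth g B w γ u y + 1 / 2 * ‖x - primalPoint g B w γ u y‖ ^ 2
      ≤ 1 / 2 * ‖x - u‖ ^ 2 + γ * (g x).toReal + γ * ⟪x, weightedAdjoint B w y⟫_ℝ := by
  have h₁ := hg.prox_growth hγ (u - γ • weightedAdjoint B w y) hx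
  have hp : prox γ g (u - γ • weightedAdjoint B w y) = primalPoint g B w γ u y := rfl
  rw [hp] at h₁
  rw [dualSmooth]
  set p := primalPoint g B w γ u y
  set a := weightedAdjoint B w y
  have h₂ : ∀ z : H, ‖z - (u - γ • a)‖ ^ 2
      = ‖z - u‖ ^ 2 + 2 * (γ * ⟪z, a⟫_ℝ) - 2 * (γ * ⟪u, a⟫_ℝ) + γ ^ 2 * ‖a‖ ^ 2 := by
    intro z
    have : z - (u - γ • a) = (z - u) + γ • a := by abel
    rw [this, norm_add_sq_real, real_inner_smul_right, inner_sub_left, norm_smul, mul_pow,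
      Real.norm_eq_abs, sq_abs]
    ring
  rw [h₂, h₂] at h₁
  linarith

/-- Concavity of the smooth part of the dual objective. -/
theorem dualSmooth_le (hg : GammaZero g) (hγ : 0 < γ) (y z : ∀ i, G i) :
    dualSmooth g B w γ u z ≤ dualSmooth g B w γ u y
      + γ * ⟪primalPoint g B w γ u y, weightedAdjoint B w z - weightedAdjoint B w y⟫_ℝ := by
  have h₁ := dualSmooth_add_le (B := B) (w := w) (u := u) hg hγ z
    (primalPoint_ne_top (B := B) (w := w) (u := u) hg hγ y)
  rw [inner_sub_right, dualSmooth.eq_def g B w γ u y]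
  nlinarith [sq_nonneg ‖primalPoint g B w γ u y - primalPoint g B w γ u z‖]

/-- The descent inequality for the smooth part of the dual objective. -/
theorem le_dualSmooth (hg : GammaZero g) (hγ : 0 < γ) (hw : ∀ i, 0 < w i) (y z : ∀ i, G i) :
    dualSmooth g B w γ u y
      + γ * ⟪primalPoint g B w γ u y, weightedAdjoint B w z - weightedAdjoint B w y⟫_ℝ
      - γ ^ 2 / 2 * ((∑ i, w i * ‖B i‖ ^ 2) * weightedNormSq w (z - y))
      ≤ dualSmooth g B w γ u z := by
  have h₁ := dualSmooth_add_le (B := B) (w := w) (u := u) hg hγ y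
    (primalPoint_ne_top (B := B) (w := w) (u := u) hg hγ z)
  have h₂ := norm_weightedAdjoint_sq_le (B := B) hw (z - y)
  rw [weightedAdjoint_sub] at h₂
  rw [dualSmooth.eq_def g B w γ u z]
  set p := primalPoint g B w γ u y
  set q := primalPoint g B w γ u z
  set a := weightedAdjoint B w y
  set b := weightedAdjoint B w z
  -- Completing the square absorbs `γ ⟪q - p, b - a⟫` into the quadratic growth term `½‖q - p‖²`.
  have h₃ : 0 ≤ ‖(q - p) + γ • (b - a)‖ ^ 2 := sq_nonneg _
  rw [norm_add_sq_real, real_inner_smul_right, norm_smul, mul_pow, Real.norm_eq_abs,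
    sq_abs, inner_sub_left] at h₃
  have h₄ : γ * ⟪q, b⟫_ℝ = γ * ⟪q, b - a⟫_ℝ + γ * ⟪q, a⟫_ℝ := by rw [inner_sub_right]; ring
  have h₅ := mul_le_mul_of_nonneg_left h₂ (by positivity : 0 ≤ γ ^ 2 / 2)
  nlinarith

/-- Weak duality, with the distance of the primal point to the primal solution. -/
theorem norm_sub_primalPoint_sq_le (hg : GammaZero g) (hh : ∀ i, GammaZero (h i)) (hγ : 0 < γ)
    {y : ∀ i, G i} (hy : DualFeasible h w y) {x : H} (hx : nonsmooth g h B x ≠ ⊤) :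
    1 / 2 * ‖x - primalPoint g B w γ u y‖ ^ 2
      ≤ 1 / 2 * ‖x - u‖ ^ 2 + γ * (nonsmooth g h B x).toReal - dualValue g h B w γ u y := by
  obtain ⟨hgx, hhx⟩ := (nonsmooth_ne_top_iff B hg hh).1 hx
  have h₁ := dualSmooth_add_le (B := B) (w := w) (u := u) hg hγ y hgx
  have h₂ : ⟪x, weightedAdjoint B w y⟫_ℝ
      ≤ ∑ i, (h i (B i x)).toReal + ∑ i, (conjugate (h i) (w i • y i)).toReal := by
    rw [inner_weightedAdjoint, ← Finset.sum_add_distrib]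
    refine Finset.sum_le_sum fun i _ => ?_
    rw [← real_inner_smul_right]
    exact (hh i).inner_le_add_conjugate (hhx i) (hy i)
  rw [toReal_nonsmooth B hg hh hgx hhx, dualValue]
  have h₃ := mul_le_mul_of_nonneg_left h₂ hγ.le
  linarith

variable [∀ i, ProperSpace (G i)]

/-- The forward-backward inequality of the inner loop. -/
theorem dualValue_sub_le (hg : GammaZero g) (hh : ∀ i, GammaZero (h i)) (hγ : 0 < γ)
    (hlam : 0 < lam) (hw : ∀ i, 0 < w i) (y : ∀ i, G i) {z : ∀ i, G i}
    (hz : DualFeasible h w z) :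
    dualValue g h B w γ u z - dualValue g h B w γ u (dualStep g h B w γ lam u y)
      ≤ γ ^ 2 / (2 * lam) * (weightedNormSq w (y - z)
          - weightedNormSq w (dualStep g h B w γ lam u y - z))
        + γ ^ 2 / (2 * lam) * (lam * (∑ i, w i * ‖B i‖ ^ 2) - 1)
          * weightedNormSq w (dualStep g h B w γ lam u y - y) := by
  have h₁ := dualStep_inequality (g := g) (B := B) (u := u) hh hγ hlam hw y hz
  have h₂ := dualSmooth_le (B := B) (w := w) (u := u) hg hγ y z
  have h₃ := le_dualSmooth (B := B) (u := u) hg hγ hw y (dualStep g h B w γ lam u y)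
  -- The factor `γ² / lam` turns the coefficient `lam / γ` of the step inequality into the `γ` of
  -- the dual objective.
  have h₄ := mul_le_mul_of_nonneg_left h₁ (by positivity : 0 ≤ γ ^ 2 / lam)
  rw [dualValue, dualValue]
  set y' := dualStep g h B w γ lam u y
  set p := primalPoint g B w γ u y
  rw [inner_sub_right] at h₂ h₃ h₄
  set β := ∑ i, w i * ‖B i‖ ^ 2
  have h₅ : ∀ a, γ ^ 2 / lam * (lam / γ * a) = γ * a := by intro a; field_simp
  rw [mul_add, h₅, h₅] at h₄
  have h₆ : γ ^ 2 / lam * (1 / 2 * (weightedNormSq w (y' - y) + weightedNormSq w (y' - z)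
      - weightedNormSq w (y - z))) = γ ^ 2 / (2 * lam) * weightedNormSq w (y' - y)
      - γ ^ 2 / (2 * lam) * (weightedNormSq w (y - z) - weightedNormSq w (y' - z)) := by
    field_simp; ring
  have h₇ : γ ^ 2 / (2 * lam) * (lam * β - 1) * weightedNormSq w (y' - y)
      = γ ^ 2 / 2 * (β * weightedNormSq w (y' - y))
        - γ ^ 2 / (2 * lam) * weightedNormSq w (y' - y) := by
    field_simp
  rw [h₆] at h₄
  rw [h₇]
  linarith

end Dual

/-- If the increase of `Q` controls the defect `D` in a Lyapunov-type inequality that compares `Q`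
with the value `q`, then every upper bound of `Q` is at least `q`. -/
theorem le_of_dissipation {Q D A : ℕ → ℝ} {ℓ q c₁ c₂ c₃ : ℝ} (hc₁ : 0 < c₁)
    (hc₂ : 0 ≤ c₂) (hc₃ : 0 ≤ c₃) (hA : ∀ n, 0 ≤ A n)
    (hQ : ∀ n, Q n ≤ ℓ)
    (h₁ : ∀ n, c₁ * D n ≤ Q (n + 1) - Q n)
    (h₂ : ∀ n, q - Q (n + 1) ≤ c₂ * (A n - A (n + 1)) + c₃ * D n) : q ≤ ℓ := by
  by_contra! hlt
  -- In this combination the defects `D n` cancel. If `ℓ < q`, then `W` drops by at least `q - ℓ` at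
  -- every step, although it is bounded below.
  set W : ℕ → ℝ := fun n => c₂ * A n - c₃ / c₁ * Q n with hW
  have hstep : ∀ n, q - ℓ ≤ W n - W (n + 1) := by
    intro n
    have h₃ := mul_le_mul_of_nonneg_left (h₁ n) (by positivity : 0 ≤ c₃ / c₁)
    have h₄ : c₃ / c₁ * (c₁ * D n) = c₃ * D n := by field_simp
    have h₅ := h₂ n
    have h₆ := hQ (n + 1)
    simp only [hW]
    linarith
  have hsum : ∀ n : ℕ, n * (q - ℓ) ≤ W 0 - W n := by
    intro n
    induction n with
    | zero => simp
    | succ n ih =>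
      push_cast
      have := hstep n
      linarith
  obtain ⟨n, hn⟩ := exists_nat_gt ((W 0 + c₃ / c₁ * ℓ) / (q - ℓ))
  rw [div_lt_iff₀ (sub_pos.2 hlt)] at hn
  have h₇ := hsum n
  have h₈ := mul_le_mul_of_nonneg_left (hQ n) (by positivity : 0 ≤ c₃ / c₁)
  have h₉ := mul_nonneg hc₂ (hA n)
  simp only [hW] at h₇ hn
  linarith

end CompositeSplitting

namespace CompositeSplitting

/-! ### Absence of a duality gap

The dual problem of the inner loop need not have a solution. A penalization argument produces dual
points whose values approach the primal value. -/

section StrongDuality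

variable {H : Type*} [NormedAddCommGroup H] [InnerProductSpace ℝ H]
  {m : ℕ} {G : Fin m → Type*} [∀ i, NormedAddCommGroup (G i)]
  [∀ i, InnerProductSpace ℝ (G i)]

/-- The Hilbert space `H × G_1 × … × G_m`. -/
abbrev PairSpace (H : Type*) {m : ℕ} (G : Fin m → Type*) : Type _ :=
  WithLp 2 (H × PiLp 2 G)

/-- The point `(x, d)` of `H × G_1 × … × G_m`. -/
def pair (x : H) (d : ∀ i, G i) : PairSpace H G :=
  WithLp.toLp 2 (x, WithLp.toLp 2 d)

/-- The projection onto the factor `G i`. -/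
def sndProj (H : Type*) [NormedAddCommGroup H] [InnerProductSpace ℝ H]
    (G : Fin m → Type*) [∀ i, NormedAddCommGroup (G i)] [∀ i, InnerProductSpace ℝ (G i)]
    (i : Fin m) : PairSpace H G →L[ℝ] G i :=
  (PiLp.proj 2 G i).comp (WithLp.sndL 2 ℝ H (PiLp 2 G))

/-- The continuous linear map into `H × G_1 × … × G_m` with the given components. -/
def pairMap {X : Type*} [NormedAddCommGroup X] [InnerProductSpace ℝ X] (A : X →L[ℝ] H)
    (C : ∀ i, X →L[ℝ] G i) : X →L[ℝ] PairSpace H G :=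
  (WithLp.prodContinuousLinearEquiv 2 ℝ H (PiLp 2 G)).symm.toContinuousLinearMap.comp
    (A.prod ((PiLp.continuousLinearEquiv 2 ℝ G).symm.toContinuousLinearMap.comp
      (ContinuousLinearMap.pi C)))

theorem pairMap_apply {X : Type*} [NormedAddCommGroup X] [InnerProductSpace ℝ X] (A : X →L[ℝ] H)
    (C : ∀ i, X →L[ℝ] G i) (z : X) : pairMap A C z = pair (A z) fun i => C i z := rfl

theorem inner_pair (x x' : H) (d d' : ∀ i, G i) :
    ⟪pair x d, pair x' d'⟫_ℝ = ⟪x, x'⟫_ℝ + ∑ i, ⟪d i, d' i⟫_ℝ := rfl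

theorem norm_pair_sq (x : H) (d : ∀ i, G i) : ‖pair x d‖ ^ 2 = ‖x‖ ^ 2 + ∑ i, ‖d i‖ ^ 2 := by
  rw [← real_inner_self_eq_norm_sq, inner_pair]
  simp only [real_inner_self_eq_norm_sq]

theorem pair_sub (x x' : H) (d d' : ∀ i, G i) :
    pair x d - pair x' d' = pair (x - x') fun i => d i - d' i := rfl

theorem exists_eq_pair (z : PairSpace H G) : ∃ x d, z = pair x d := ⟨z.fst, fun i => z.snd i, rfl⟩

/-- The separable function `(x, r) ↦ g(x) + ∑ i, h_i(r_i)`. -/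
def separable (g : H → EReal) (h : ∀ i, G i → EReal) : PairSpace H G → EReal :=
  nonsmooth (fun z => g (WithLp.fstL 2 ℝ H (PiLp 2 G) z)) h (sndProj H G)

theorem separable_pair (g : H → EReal) (h : ∀ i, G i → EReal) (x : H) (r : ∀ i, G i) :
    separable g h (pair x r) = g x + ∑ i, h i (r i) := rfl

/-- The map `(x, d) ↦ (x, (B_i x - s d_i)_i)`. -/
def penaltyMap (B : ∀ i, H →L[ℝ] G i) (s : ℝ) : PairSpace H G →L[ℝ] PairSpace H G :=
  pairMap (WithLp.fstL 2 ℝ H (PiLp 2 G)) (fun i => (B i).comp (WithLp.fstL 2 ℝ H (PiLp 2 G)))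
    - s • pairMap 0 (sndProj H G)

theorem penaltyMap_pair (B : ∀ i, H →L[ℝ] G i) (s : ℝ) (x : H) (d : ∀ i, G i) :
    penaltyMap B s (pair x d) = pair x fun i => B i x - s • d i := by
  have h₁ : s • pairMap (0 : PairSpace H G →L[ℝ] H) (sndProj H G) (pair x d)
      = pair (s • (0 : H)) fun i => s • d i := rfl
  rw [penaltyMap, sub_apply, smul_apply, h₁, smul_zero,
    pairMap_apply, pair_sub, sub_zero]
  rfl

variable {g : H → EReal} {h : ∀ i, G i → EReal} {B : ∀ i, H →L[ℝ] G i} {w : Fin m → ℝ}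
  {γ lam : ℝ} {u : H}

theorem gammaZero_fst (hg : GammaZero g) :
    GammaZero fun z : PairSpace H G => g (WithLp.fstL 2 ℝ H (PiLp 2 G) z) := by
  obtain ⟨x, hx⟩ := hg.proper
  exact hg.comp _ ⟨pair x 0, hx⟩

theorem separable_ne_top_iff (hg : GammaZero g) (hh : ∀ i, GammaZero (h i)) {x : H}
    {r : ∀ i, G i} : separable g h (pair x r) ≠ ⊤ ↔ g x ≠ ⊤ ∧ ∀ i, h i (r i) ≠ ⊤ :=
  nonsmooth_ne_top_iff (sndProj H G) (gammaZero_fst hg) hh (x := pair x r)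

theorem toReal_separable (hg : GammaZero g) (hh : ∀ i, GammaZero (h i)) {x : H}
    {r : ∀ i, G i} (hx : g x ≠ ⊤) (hr : ∀ i, h i (r i) ≠ ⊤) :
    (separable g h (pair x r)).toReal = (g x).toReal + ∑ i, (h i (r i)).toReal :=
  toReal_nonsmooth (sndProj H G) (gammaZero_fst hg) hh (x := pair x r) hx hr

theorem gammaZero_separable (hg : GammaZero g) (hh : ∀ i, GammaZero (h i)) :
    GammaZero (separable g h) := by
  obtain ⟨x, hx⟩ := hg.proper
  choose r hr using fun i => (hh i).proper
  exact gammaZero_nonsmooth _ (gammaZero_fst hg) hh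
    ⟨pair x r, (separable_ne_top_iff hg hh).2 ⟨hx, hr⟩⟩

theorem separable_penaltyMap_zero (x : H) (s : ℝ) :
    separable g h (penaltyMap B s (pair x 0)) = nonsmooth g h B x := by
  rw [penaltyMap_pair, separable_pair]
  simp [nonsmooth]

theorem gammaZero_penalty (hg : GammaZero g) (hh : ∀ i, GammaZero (h i))
    (hdom : ∃ x, nonsmooth g h B x ≠ ⊤) (s : ℝ) :
    GammaZero fun z => separable g h (penaltyMap B s z) := by
  obtain ⟨x, hx⟩ := hdom
  refine (gammaZero_separable hg hh).comp (penaltyMap B s) ⟨pair x 0, ?_⟩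
  rwa [separable_penaltyMap_zero]

variable [CompleteSpace H] [∀ i, CompleteSpace (G i)] [ProperSpace (PairSpace H G)]

/-- The minimizers of the penalized problems are bounded. -/
theorem exists_norm_penalty_prox_le (hg : GammaZero g) (hh : ∀ i, GammaZero (h i))
    (hdom : ∃ x, nonsmooth g h B x ≠ ⊤) (hγ : 0 < γ) :
    ∃ R : ℝ, ∀ s : ℝ, 0 < s → s ≤ 1 →
      ‖prox γ (fun z => separable g h (penaltyMap B s z)) (pair u 0) - pair u 0‖ ≤ R := by
  obtain ⟨x₀, hx₀⟩ := hdom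
  obtain ⟨C, hC, hCK⟩ := (gammaZero_separable hg hh).exists_norm_le
  set T : PairSpace H G →L[ℝ] PairSpace H G := penaltyMap B 0 with hT
  set S : PairSpace H G →L[ℝ] PairSpace H G := pairMap 0 (sndProj H G) with hS
  set M : ℝ := 1 / 2 * ‖x₀ - u‖ ^ 2 + γ * (nonsmooth g h B x₀).toReal with hM
  set N : ℝ := ‖T‖ + ‖S‖ with hN
  set U : PairSpace H G := pair u 0 with hU
  have hN0 : 0 ≤ N := by positivity
  -- The bound does not depend on `s`: the competitor `(x₀, 0)` has penalized value `M` for every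
  -- `s`, and `N` bounds the norm of `penaltyMap B s` for `0 < s ≤ 1`.
  refine ⟨2 * (|M| + γ * C * (1 + N * ‖U‖)) + 2 * (γ * C * N) + 1, fun s hs hs1 => ?_⟩
  have hψ := gammaZero_penalty (B := B) hg hh ⟨x₀, hx₀⟩ s
  obtain ⟨hfin, hmin⟩ := hψ.prox_spec hγ U
  set Z := prox γ (fun z => separable g h (penaltyMap B s z)) U
  have h₁ := hmin (pair x₀ 0) (by rwa [separable_penaltyMap_zero])
  rw [separable_penaltyMap_zero] at h₁
  have h₂ : ‖pair x₀ (0 : ∀ i, G i) - U‖ ^ 2 = ‖x₀ - u‖ ^ 2 := by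
    rw [hU, pair_sub, norm_pair_sq]
    simp
  rw [h₂, ← hM] at h₁
  have h₃ := hCK (penaltyMap B s Z)
  rw [← (gammaZero_separable hg hh).coe_toReal hfin, EReal.coe_le_coe_iff] at h₃
  have h₄ : ‖penaltyMap B s Z‖ ≤ N * ‖Z‖ := by
    have h₅ : penaltyMap B s Z = T Z - s • S Z := by
      rw [hT, penaltyMap, penaltyMap, zero_smul, sub_zero]
      rfl
    rw [h₅]
    refine (norm_sub_le _ _).trans ?_
    rw [norm_smul, Real.norm_eq_abs, abs_of_pos hs]
    have h₆ := T.le_opNorm Z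
    have h₇ := S.le_opNorm Z
    nlinarith [norm_nonneg (S Z)]
  have h₅ : ‖Z‖ ≤ ‖Z - U‖ + ‖U‖ := by simpa using norm_add_le (Z - U) U
  have h₆ : -(C * (1 + N * (‖Z - U‖ + ‖U‖))) ≤ (separable g h (penaltyMap B s Z)).toReal := by
    refine le_trans (neg_le_neg ?_) h₃
    have : N * ‖Z‖ ≤ N * (‖Z - U‖ + ‖U‖) := mul_le_mul_of_nonneg_left h₅ hN0
    exact mul_le_mul_of_nonneg_left (by linarith) hC
  refine le_of_sq_le_add_mul (by positivity) (by positivity) ?_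
  have h₇ := mul_le_mul_of_nonneg_left h₆ hγ.le
  nlinarith [le_abs_self M]

variable [ProperSpace H]

/-- The minimizer of the penalized problem yields a dual point with a good dual value. -/
theorem exists_dualValue_ge_penalty (hg : GammaZero g) (hh : ∀ i, GammaZero (h i))
    (hdom : ∃ x, nonsmooth g h B x ≠ ⊤) (hw : ∀ i, 0 < w i) (hγ : 0 < γ) {s : ℝ} (hs : 0 < s) :
    ∃ (x : H) (r : ∀ i, G i) (y : ∀ i, G i),
      penaltyMap B s (prox γ (fun z => separable g h (penaltyMap B s z)) (pair u 0)) = pair x r ∧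
      separable g h (pair x r) ≠ ⊤ ∧ DualFeasible h w y ∧
      1 / 2 * ‖x - u‖ ^ 2 + γ * (separable g h (pair x r)).toReal ≤ dualValue g h B w γ u y := by
  have hψ := gammaZero_penalty hg hh hdom s
  have hfin := hψ.prox_ne_top hγ (pair u 0)
  have hvi := fun X hX => hψ.inner_prox_le hγ (pair u 0) (x := X) hX
  obtain ⟨x, d, hxd⟩ := exists_eq_pair
    (prox γ (fun z => separable g h (penaltyMap B s z)) (pair u 0))
  rw [hxd] at hfin hvi ⊢
  rw [penaltyMap_pair] at hfin hvi ⊢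
  obtain ⟨hgx, hhr⟩ := (separable_ne_top_iff hg hh).1 hfin
  set r : ∀ i, G i := fun i => B i x - s • d i with hr
  replace hhr : ∀ i, h i (r i) ≠ ⊤ := hhr
  -- Stationarity in `d_i` reads `d_i = γ s ξ_i` with `ξ_i` a subgradient of `h_i` at `r_i`; here
  -- `w_i y_i` is `ξ_i`.
  set y : ∀ i, G i := fun i => (1 / (w i * (γ * s))) • d i with hy
  have hwy : ∀ i, w i • y i = (1 / (γ * s)) • d i := by
    intro i
    have := (hw i).ne'
    rw [hy, smul_smul]
    congr 1
    field_simp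
  have hd : ∀ i, d i = (γ * s) • (w i • y i) := by
    intro i
    rw [hwy, smul_smul, mul_one_div_cancel (by positivity), one_smul]
  -- Since `s > 0`, every `(x', ρ)` is an image under `penaltyMap B s`, so the two components vary
  -- independently. Varying `x'` shows that `x` is the primal point of `y`; varying one `ρ_i` gives
  -- the subgradient property.
  have key : ∀ (x' : H) (ρ : ∀ i, G i), g x' ≠ ⊤ → (∀ i, h i (ρ i) ≠ ⊤) →
      ⟪u - γ • weightedAdjoint B w y - x, x' - x⟫_ℝ + γ * ∑ i, ⟪w i • y i, ρ i - r i⟫_ℝ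
        ≤ γ * ((g x').toReal - (g x).toReal
          + ∑ i, ((h i (ρ i)).toReal - (h i (r i)).toReal)) := by
    intro x' ρ hx' hρ
    have h₁ : penaltyMap B s (pair x' fun i => (1 / s) • (B i x' - ρ i)) = pair x' ρ := by
      rw [penaltyMap_pair]
      congr 1
      funext i
      rw [smul_smul, mul_one_div_cancel hs.ne', one_smul, sub_sub_cancel]
    have h₂ := hvi (pair x' fun i => (1 / s) • (B i x' - ρ i))
      (by rw [h₁]; exact (separable_ne_top_iff hg hh).2 ⟨hx', hρ⟩)
    rw [h₁, toReal_separable hg hh hx' hρ, toReal_separable hg hh hgx hhr, pair_sub, pair_sub,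
      inner_pair] at h₂
    have h₃ : ∑ i, ⟪(0 : ∀ i, G i) i - d i, (1 / s) • (B i x' - ρ i) - d i⟫_ℝ
        = -(γ * ⟪weightedAdjoint B w y, x' - x⟫_ℝ) + γ * ∑ i, ⟪w i • y i, ρ i - r i⟫_ℝ := by
      rw [real_inner_comm, inner_weightedAdjoint, Finset.mul_sum, Finset.mul_sum,
        ← Finset.sum_neg_distrib, ← Finset.sum_add_distrib]
      refine Finset.sum_congr rfl fun i _ => ?_
      have h₄ : (1 / s) • (B i x' - ρ i) - d i
          = (1 / s) • (B i (x' - x) - (ρ i - r i)) := by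
        have h₅ : d i = (1 / s) • (s • d i) := by
          rw [smul_smul, one_div_mul_cancel hs.ne', one_smul]
        rw [h₅, ← smul_sub, map_sub]
        congr 1
        simp only [hr]
        abel
      rw [h₄, Pi.zero_apply, zero_sub, inner_neg_left, real_inner_smul_right, hd i,
        real_inner_smul_left, inner_sub_right, real_inner_comm, real_inner_smul_right]
      field_simp
      ring
    rw [h₃] at h₂
    rw [sub_right_comm, inner_sub_left, real_inner_smul_left, Finset.sum_sub_distrib]
    linarith
  have hp : primalPoint g B w γ u y = x := by
    refine hg.prox_eq hγ hgx fun x' hx' => ?_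
    have h₁ := key x' r hx' hhr
    simp only [sub_self, inner_zero_right, Finset.sum_const_zero, mul_zero, add_zero] at h₁
    exact h₁
  have hconj : ∀ i, conjugate (h i) (w i • y i) ≠ ⊤ ∧
      (conjugate (h i) (w i • y i)).toReal ≤ ⟪w i • y i, r i⟫_ℝ - (h i (r i)).toReal := by
    intro i
    refine (hh i).conjugate_le fun ρ hρ => ?_
    have h₁ := key x (Function.update r i ρ) hgx (by
      intro j
      rcases eq_or_ne j i with rfl | hj
      · rwa [Function.update_self]
      · rw [Function.update_of_ne hj]; exact hhr j)
    rw [Finset.sum_eq_single i (fun j _ hj => by simp [Function.update_of_ne hj]) (by simp),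
      Finset.sum_eq_single i (fun j _ hj => by simp [Function.update_of_ne hj]) (by simp),
      Function.update_self, sub_self, inner_zero_right, zero_add, sub_self, zero_add] at h₁
    have h₂ := le_of_mul_le_mul_left h₁ hγ
    rw [inner_sub_right] at h₂
    rw [real_inner_comm]
    linarith
  refine ⟨x, r, y, rfl, hfin, fun i => (hconj i).1, ?_⟩
  rw [toReal_separable hg hh hgx hhr, dualValue, dualSmooth, hp, inner_weightedAdjoint]
  have h₁ : ∑ i, (conjugate (h i) (w i • y i)).toReal
      ≤ ∑ i, w i * ⟪B i x, y i⟫_ℝ - ∑ i, (h i (r i)).toReal := by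
    rw [← Finset.sum_sub_distrib]
    refine Finset.sum_le_sum fun i _ => (hconj i).2.trans ?_
    -- Replacing `r_i` by `B_i x` costs only a term of favourable sign, because `B_i x - r_i = s
    -- d_i` is a positive multiple of `w_i y_i`.
    have h₂ : ⟪w i • y i, r i⟫_ℝ
        = w i * ⟪B i x, y i⟫_ℝ - s * (γ * s) * ‖w i • y i‖ ^ 2 := by
      simp only [hr]
      rw [inner_sub_right, real_inner_smul_right, hd i, real_inner_smul_right,
        real_inner_self_eq_norm_sq, real_inner_smul_left, real_inner_comm]
      ring
    rw [h₂]
    have : 0 ≤ s * (γ * s) * ‖w i • y i‖ ^ 2 := by positivity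
    linarith
  have h₂ := mul_le_mul_of_nonneg_left h₁ hγ.le
  linarith

/-- There is no duality gap in the inner loop. -/
theorem exists_dualValue_gt (hg : GammaZero g) (hh : ∀ i, GammaZero (h i))
    (hdom : ∃ x, nonsmooth g h B x ≠ ⊤) (hw : ∀ i, 0 < w i) (hγ : 0 < γ) {c : ℝ}
    (hc : c < 1 / 2 * ‖prox γ (nonsmooth g h B) u - u‖ ^ 2
      + γ * (nonsmooth g h B (prox γ (nonsmooth g h B) u)).toReal) :
    ∃ y : ∀ i, G i, DualFeasible h w y ∧ c < dualValue g h B w γ u y := by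
  by_contra! hcon
  have hK := gammaZero_separable hg hh
  obtain ⟨R, hR⟩ := exists_norm_penalty_prox_le (B := B) (u := u) hg hh hdom hγ
  set s : ℕ → ℝ := fun n => 1 / ((n : ℝ) + 1) with hs
  have hs0 : ∀ n, 0 < s n := fun n => Nat.one_div_pos_of_nat
  have hs1 : ∀ n, s n ≤ 1 := fun n => by
    rw [hs]
    exact div_le_one_of_le₀ (by linarith [(Nat.cast_nonneg n : (0 : ℝ) ≤ n)]) (by positivity)
  set Z : ℕ → PairSpace H G := fun n =>
    prox γ (fun z => separable g h (penaltyMap B (s n) z)) (pair u 0) with hZ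
  obtain ⟨Zl, -, k, hk, hZl⟩ := tendsto_subseq_of_bounded
    (Metric.isBounded_closedBall (x := pair u (0 : ∀ i, G i)) (r := R)) (x := Z) fun n => by
      rw [Metric.mem_closedBall, dist_eq_norm]
      exact hR (s n) (hs0 n) (hs1 n)
  set T : PairSpace H G →L[ℝ] PairSpace H G := penaltyMap B 0 with hT
  set S : PairSpace H G →L[ℝ] PairSpace H G := pairMap 0 (sndProj H G) with hS
  have hTs : ∀ n z, penaltyMap B (s n) z = T z - s n • S z := by
    intro n z
    rw [hT, penaltyMap, penaltyMap, zero_smul, sub_zero]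
    rfl
  have hsk : Tendsto (fun n => s (k n)) atTop (𝓝 0) :=
    tendsto_one_div_add_atTop_nhds_zero_nat.comp hk.tendsto_atTop
  have hlim : Tendsto (fun n => penaltyMap B (s (k n)) (Z (k n))) atTop (𝓝 (T Zl)) := by
    simp only [hTs]
    have h₁ := ((T.continuous.tendsto Zl).comp hZl).sub
      (hsk.smul ((S.continuous.tendsto Zl).comp hZl))
    rwa [zero_smul, sub_zero] at h₁
  have hfst : Continuous fun z : PairSpace H G => WithLp.fstL 2 ℝ H (PiLp 2 G) z :=
    (WithLp.fstL 2 ℝ H (PiLp 2 G)).continuous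
  -- If all dual values were at most `c`, the value of `separable g h` at each penalized minimizer's
  -- image would be at most `b` there. Closedness of the epigraph carries this to a limit `(x, Bx)`,
  -- whose primal value would then lie below the optimum.
  set b : PairSpace H G → ℝ := fun z =>
    (c - 1 / 2 * ‖WithLp.fstL 2 ℝ H (PiLp 2 G) z - u‖ ^ 2) / γ with hb
  have hbcont : Continuous b := by
    rw [hb]
    fun_prop
  have hepi : ∀ n, separable g h (penaltyMap B (s n) (Z n))
      ≤ (b (penaltyMap B (s n) (Z n)) : EReal) := by
    intro n
    obtain ⟨x, r, y, hxr, hfin, hy, hle⟩ :=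
      exists_dualValue_ge_penalty (u := u) hg hh hdom hw hγ (hs0 n)
    have hxr' : penaltyMap B (s n) (Z n) = pair x r := hxr
    rw [hxr', ← hK.coe_toReal hfin, EReal.coe_le_coe_iff]
    have hbx : b (pair x r) = (c - 1 / 2 * ‖x - u‖ ^ 2) / γ := rfl
    rw [hbx, le_div_iff₀ hγ]
    have := hcon y hy
    linarith
  have hcl : separable g h (T Zl) ≤ (b (T Zl) : EReal) := by
    have hmem : (T Zl, ((b (T Zl) : ℝ) : EReal)) ∈
        {p : PairSpace H G × EReal | separable g h p.1 ≤ p.2} := by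
      refine hK.lsc.isClosed_epigraph.mem_of_tendsto (b := atTop) (f := fun n =>
        (penaltyMap B (s (k n)) (Z (k n)), ((b (penaltyMap B (s (k n)) (Z (k n))) : ℝ) : EReal)))
        ?_ (Eventually.of_forall fun n => hepi (k n))
      exact hlim.prodMk_nhds ((continuous_coe_real_ereal.comp hbcont).tendsto _ |>.comp hlim)
    exact hmem
  obtain ⟨x, d, rfl⟩ := exists_eq_pair Zl
  have hTx : T (pair x d) = pair x fun i => B i x := by
    rw [hT, penaltyMap_pair]
    simp
  rw [hTx] at hcl
  have hbx : b (pair x fun i => B i x) = (c - 1 / 2 * ‖x - u‖ ^ 2) / γ := rfl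
  have hns : separable g h (pair x fun i => B i x) = nonsmooth g h B x := rfl
  rw [hbx, hns] at hcl
  have hx : nonsmooth g h B x ≠ ⊤ := ne_top_of_le_ne_top (EReal.coe_ne_top _) hcl
  have hnsΓ := gammaZero_nonsmooth B hg hh hdom
  rw [← hnsΓ.coe_toReal hx, EReal.coe_le_coe_iff, le_div_iff₀ hγ] at hcl
  have := (hnsΓ.prox_spec hγ u).2 x hx
  linarith

/-- The inner loop computes the proximal point of the nonsmooth part. -/
theorem tendsto_primalPoint [∀ i, ProperSpace (G i)] (hg : GammaZero g)
    (hh : ∀ i, GammaZero (h i)) (hdom : ∃ x, nonsmooth g h B x ≠ ⊤) (hw : ∀ i, 0 < w i)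
    (hγ : 0 < γ) (hlam : 0 < lam) (hlam_lt : lam * ∑ i, w i * ‖B i‖ ^ 2 < 2)
    {y : ℕ → ∀ i, G i} (hy : ∀ j, y (j + 1) = dualStep g h B w γ lam u (y j)) :
    Tendsto (fun j => primalPoint g B w γ u (y j)) atTop
      (𝓝 (prox γ (nonsmooth g h B) u)) := by
  have hnsΓ := gammaZero_nonsmooth B hg hh hdom
  have hx := hnsΓ.prox_ne_top hγ u
  set x := prox γ (nonsmooth g h B) u with hxdef
  set P : ℝ := 1 / 2 * ‖x - u‖ ^ 2 + γ * (nonsmooth g h B x).toReal with hP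
  -- The index starts at one because the arbitrary `y 0` may be infeasible, and `toReal` would then
  -- hide an infinite conjugate.
  set Q : ℕ → ℝ := fun j => dualValue g h B w γ u (y (j + 1)) with hQ
  set D : ℕ → ℝ := fun j => weightedNormSq w (y (j + 2) - y (j + 1)) with hD
  set β := ∑ i, w i * ‖B i‖ ^ 2 with hβ
  have hβ0 : 0 ≤ β := Finset.sum_nonneg fun i _ => mul_nonneg (hw i).le (sq_nonneg _)
  have hfeas : ∀ j, DualFeasible h w (y (j + 1)) := fun j => by
    rw [hy]; exact dualFeasible_dualStep hh hγ hlam hw _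
  have hFB : ∀ j z, DualFeasible h w z → dualValue g h B w γ u z - Q (j + 1)
      ≤ γ ^ 2 / (2 * lam) * (weightedNormSq w (y (j + 1) - z)
          - weightedNormSq w (y (j + 2) - z)) + γ ^ 2 / (2 * lam) * (lam * β - 1) * D j := by
    intro j z hz
    have h₁ := dualValue_sub_le (B := B) (u := u) hg hh hγ hlam hw (y (j + 1)) hz
    rw [← hy] at h₁
    exact h₁
  have hD0 : ∀ j, 0 ≤ D j := fun j => weightedNormSq_nonneg hw _
  have hγl : 0 < γ ^ 2 / (2 * lam) := by positivity
  have hinc : ∀ j, γ ^ 2 / (2 * lam) * (2 - lam * β) * D j ≤ Q (j + 1) - Q j := by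
    intro j
    -- Comparison with the current iterate itself yields the ascent estimate, with a coefficient
    -- made positive by `lam * β < 2`.
    have h₁ := hFB j (y (j + 1)) (hfeas j)
    have h₂ : weightedNormSq w (y (j + 1) - y (j + 1)) = 0 := by simp [weightedNormSq]
    rw [h₂] at h₁
    have h₃ : γ ^ 2 / (2 * lam) * (0 - D j) + γ ^ 2 / (2 * lam) * (lam * β - 1) * D j
        = -(γ ^ 2 / (2 * lam) * (2 - lam * β) * D j) := by ring
    have h₄ : dualValue g h B w γ u (y (j + 1)) = Q j := rfl
    have h₅ : weightedNormSq w (y (j + 2) - y (j + 1)) = D j := rfl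
    rw [h₄, h₅, h₃] at h₁
    linarith
  have hc₁ : 0 < γ ^ 2 / (2 * lam) * (2 - lam * β) := mul_pos hγl (by linarith)
  have hmono : Monotone Q := monotone_nat_of_le_succ fun j => by
    have := mul_nonneg hc₁.le (hD0 j)
    linarith [hinc j]
  have hgap : ∀ j, 1 / 2 * ‖x - primalPoint g B w γ u (y (j + 1))‖ ^ 2 ≤ P - Q j := fun j =>
    norm_sub_primalPoint_sq_le hg hh hγ (hfeas j) hx
  have hQP : ∀ j, Q j ≤ P := fun j => by
    have h₁ := hgap j
    have : 0 ≤ 1 / 2 * ‖x - primalPoint g B w γ u (y (j + 1))‖ ^ 2 := by positivity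
    linarith
  have hlimQ : Tendsto Q atTop (𝓝 P) := by
    refine tendsto_atTop_isLUB hmono ⟨by rintro _ ⟨j, rfl⟩; exact hQP j, fun ℓ hℓ => ?_⟩
    by_contra! hlt
    obtain ⟨z, hz, hlz⟩ := exists_dualValue_gt hg hh hdom hw hγ hlt
    -- The comparison point `z` only has to beat `ℓ`; no dual maximizer is needed. As `lam * β - 1`
    -- may be negative, `c₃` uses the larger `lam * β`.
    refine absurd (le_of_dissipation (D := D)
      (A := fun j => weightedNormSq w (y (j + 1) - z)) (c₃ := γ ^ 2 / (2 * lam) * (lam * β))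
      hc₁ hγl.le (by positivity) (fun j => weightedNormSq_nonneg hw _)
      (fun j => hℓ ⟨j, rfl⟩) hinc fun j => (hFB j z hz).trans ?_) (not_le.2 hlz)
    have : γ ^ 2 / (2 * lam) * (lam * β - 1) * D j ≤ γ ^ 2 / (2 * lam) * (lam * β) * D j :=
      mul_le_mul_of_nonneg_right (mul_le_mul_of_nonneg_left (by linarith) hγl.le) (hD0 j)
    linarith
  rw [← tendsto_add_atTop_iff_nat 1, tendsto_iff_norm_sub_tendsto_zero]
  have hsq : Tendsto (fun j => Real.sqrt (2 * (P - Q j))) atTop (𝓝 0) := by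
    have h₁ := ((hlimQ.const_sub P).const_mul 2).sqrt
    rwa [sub_self, mul_zero, Real.sqrt_zero] at h₁
  refine squeeze_zero (fun j => norm_nonneg _) (fun j => Real.le_sqrt_of_sq_le ?_) hsq
  rw [norm_sub_rev]
  linarith [hgap j]

end StrongDuality

end CompositeSplitting

namespace CompositeSplitting

/-! ### The perturbed forward-backward iteration -/

section ForwardBackward

/-- Subtracting the partial sums of `e` makes `a` decreasing and bounded below; `b n` is squeezed
between `a (n + 1) - e n` and `a n`. -/
theorem exists_tendsto_of_le_add_summable {a b e : ℕ → ℝ} (ha : ∀ n, 0 ≤ a n)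
    (hab : ∀ n, a (n + 1) ≤ b n + e n) (hba : ∀ n, b n ≤ a n) (he : Summable e) :
    ∃ ℓ, Tendsto a atTop (𝓝 ℓ) ∧ Tendsto b atTop (𝓝 ℓ) := by
  have hs : Tendsto (fun n => ∑ i ∈ Finset.range n, e i) atTop (𝓝 (∑' i, e i)) :=
    he.hasSum.tendsto_sum_nat
  set c : ℕ → ℝ := fun n => a n - ∑ i ∈ Finset.range n, e i with hc
  have hanti : Antitone c := antitone_nat_of_succ_le fun n => by
    simp only [hc, Finset.sum_range_succ]
    linarith [hab n, hba n]
  obtain ⟨M, hM⟩ := hs.bddAbove_range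
  have hbdd : BddBelow (Set.range c) := by
    refine ⟨-M, ?_⟩
    rintro _ ⟨n, rfl⟩
    have := hM ⟨n, rfl⟩
    simp only [hc] at this ⊢
    linarith [ha n]
  have hca := (tendsto_atTop_ciInf hanti hbdd).add hs
  simp only [hc, sub_add_cancel] at hca
  refine ⟨_, hca, ?_⟩
  have hlow := ((tendsto_add_atTop_iff_nat 1).2 hca).sub he.tendsto_atTop_zero
  rw [sub_zero] at hlow
  exact tendsto_of_tendsto_of_tendsto_of_le_of_le hlow hca
    (fun n => by linarith [hab n]) hba

variable {H : Type*} [NormedAddCommGroup H] [InnerProductSpace ℝ H] [CompleteSpace H]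
  {f : H → ℝ} {F : H → H} {L : ℝ≥0} {φ : H → EReal} {γ : ℝ}

variable [ProperSpace H]

/-- The forward-backward operator is averaged. -/
theorem norm_sub_forwardBackward_sq_le (hL : 0 < L)
    (hconv : ConvexOn ℝ Set.univ f) (hf : ∀ x, HasGradientAt f (F x) x)
    (hF : LipschitzWith L F) (hφ : GammaZero φ) (hγ : 0 < γ) (hγ_lt : γ < 2 / (L : ℝ)) :
    ∃ C : ℝ, 0 < C ∧ ∀ x z, prox γ φ (z - γ • F z) = z →
      ‖x - prox γ φ (x - γ • F x)‖ ^ 2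
        ≤ C * (‖x - z‖ ^ 2 - ‖prox γ φ (x - γ • F x) - z‖ ^ 2) := by
  have hL' : (0 : ℝ) < L := hL
  -- Coefficient of `‖δ‖²` that survives cocoercivity. In the constant below, `2` pays for `‖x - p -
  -- γ δ‖²` and `2γ² / κ` for `γ²‖δ‖²`.
  set κ : ℝ := γ * (2 / L - γ) with hκ
  have hκ0 : 0 < κ := mul_pos hγ (by linarith)
  refine ⟨2 + 2 * γ ^ 2 / κ, by positivity, fun x z hz => ?_⟩
  have h₁ := hφ.norm_prox_sub_prox_sq_le hγ (x - γ • F x) (z - γ • F z)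
  rw [hz] at h₁
  set p := prox γ φ (x - γ • F x)
  have h₂ := norm_sub_sq_le_mul_inner_of_convexOn hL hconv hf hF x z
  set δ := F x - F z with hδ
  have h₃ : x - γ • F x - (z - γ • F z) = (x - z) - γ • δ := by
    rw [hδ]; module
  have h₄ : (x - z) - γ • δ - (p - z) = (x - p) - γ • δ := by abel
  rw [h₃, h₄, norm_sub_sq_real (x - z), real_inner_smul_right, norm_smul, mul_pow,
    Real.norm_eq_abs, sq_abs] at h₁
  have h₅ : 1 / L * ‖δ‖ ^ 2 ≤ ⟪x - z, δ⟫_ℝ := by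
    rw [real_inner_comm, one_div, inv_mul_le_iff₀ hL']
    exact h₂
  have h₆ : κ * ‖δ‖ ^ 2 + ‖x - p - γ • δ‖ ^ 2 ≤ ‖x - z‖ ^ 2 - ‖p - z‖ ^ 2 := by
    have h₇ := mul_le_mul_of_nonneg_left h₅ (by positivity : 0 ≤ 2 * γ)
    have h₈ : κ * ‖δ‖ ^ 2 = 2 * γ * (1 / L * ‖δ‖ ^ 2) - γ ^ 2 * ‖δ‖ ^ 2 := by rw [hκ]; ring
    linarith
  have h₇ : ‖x - p‖ ^ 2 ≤ 2 * ‖x - p - γ • δ‖ ^ 2 + 2 * γ ^ 2 * ‖δ‖ ^ 2 := by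
    have h₈ : ‖x - p‖ ≤ ‖x - p - γ • δ‖ + γ * ‖δ‖ := by
      have := norm_add_le (x - p - γ • δ) (γ • δ)
      rwa [sub_add_cancel, norm_smul, Real.norm_eq_abs, abs_of_pos hγ] at this
    have h₉ := pow_le_pow_left₀ (norm_nonneg _) h₈ 2
    nlinarith [sq_nonneg (‖x - p - γ • δ‖ - γ * ‖δ‖)]
  refine h₇.trans (le_trans ?_ (mul_le_mul_of_nonneg_left h₆ (by positivity)))
  have h₈ : (2 + 2 * γ ^ 2 / κ) * (κ * ‖δ‖ ^ 2 + ‖x - p - γ • δ‖ ^ 2)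
      = 2 * ‖x - p - γ • δ‖ ^ 2 + 2 * γ ^ 2 * ‖δ‖ ^ 2 + 2 * (κ * ‖δ‖ ^ 2)
        + 2 * γ ^ 2 / κ * ‖x - p - γ • δ‖ ^ 2 := by
    field_simp
    ring
  rw [h₈]
  have : 0 ≤ 2 * (κ * ‖δ‖ ^ 2) := by positivity
  have : 0 ≤ 2 * γ ^ 2 / κ * ‖x - p - γ • δ‖ ^ 2 := by positivity
  linarith

/-- Convergence of the forward-backward iteration with summable errors. -/
theorem exists_tendsto_forwardBackward (hL : 0 < L)
    (hconv : ConvexOn ℝ Set.univ f) (hf : ∀ x, HasGradientAt f (F x) x)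
    (hF : LipschitzWith L F) (hφ : GammaZero φ) (hγ : 0 < γ) (hγ_lt : γ < 2 / (L : ℝ))
    (hfix : ∃ z, prox γ φ (z - γ • F z) = z) {e : ℕ → ℝ} (he : Summable e) {x : ℕ → H}
    (hx : ∀ k, ‖x (k + 1) - prox γ φ (x k - γ • F (x k))‖ ≤ e k) :
    ∃ z, prox γ φ (z - γ • F z) = z ∧ Tendsto x atTop (𝓝 z) := by
  obtain ⟨C, hC, hCT⟩ := norm_sub_forwardBackward_sq_le hL hconv hf hF hφ hγ hγ_lt
  set T : H → H := fun x => prox γ φ (x - γ • F x) with hT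
  have hTcont : Continuous T :=
    (hφ.continuous_prox hγ).comp (continuous_id.sub (hF.continuous.const_smul γ))
  have hfejer : ∀ z, T z = z → ∃ ℓ, Tendsto (fun k => ‖x k - z‖) atTop (𝓝 ℓ) ∧
      Tendsto (fun k => ‖T (x k) - z‖) atTop (𝓝 ℓ) := by
    intro z hz
    refine exists_tendsto_of_le_add_summable (fun k => norm_nonneg _) (fun k => ?_)
      (fun k => ?_) he
    · have := norm_add_le (T (x k) - z) (x (k + 1) - T (x k))
      rw [add_comm (T (x k) - z), sub_add_sub_cancel] at this
      linarith [hx k]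
    · have h₁ := hCT (x k) z hz
      have h₂ := nonneg_of_mul_nonneg_right ((sq_nonneg _).trans h₁) hC
      exact le_of_sq_le_sq (sub_nonneg.1 h₂) (norm_nonneg _)
  obtain ⟨z₀, hz₀⟩ := hfix
  obtain ⟨ℓ₀, hx₀, hTx₀⟩ := hfejer z₀ hz₀
  -- Both distances to `z₀` have the same limit, so the averagedness inequality forces the residual
  -- to zero.
  have hres : Tendsto (fun k => ‖x k - T (x k)‖ ^ 2) atTop (𝓝 0) := by
    have h₁ := ((hx₀.pow 2).sub (hTx₀.pow 2)).const_mul C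
    rw [sub_self, mul_zero] at h₁
    exact squeeze_zero (fun k => sq_nonneg _) (fun k => hCT (x k) z₀ hz₀) h₁
  obtain ⟨R, hR⟩ := hx₀.bddAbove_range
  obtain ⟨z, -, s, hs, hsz⟩ := tendsto_subseq_of_bounded
    (Metric.isBounded_closedBall (x := z₀) (r := R)) (x := x) fun k => by
      rw [Metric.mem_closedBall, dist_eq_norm]
      exact hR ⟨k, rfl⟩
  have hz : T z = z := by
    have h₁ : Tendsto (fun k => ‖x (s k) - T (x (s k))‖ ^ 2) atTop (𝓝 (‖z - T z‖ ^ 2)) :=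
      ((hsz.sub ((hTcont.tendsto z).comp hsz)).norm).pow 2
    have h₂ := tendsto_nhds_unique h₁ (hres.comp hs.tendsto_atTop)
    rw [sq_eq_zero_iff, norm_eq_zero, sub_eq_zero] at h₂
    exact h₂.symm
  -- The distance to the cluster point converges along the whole sequence, and a subsequence shows
  -- that its limit is zero.
  obtain ⟨ℓ, hxz, -⟩ := hfejer z hz
  have hℓ : ℓ = 0 := by
    refine tendsto_nhds_unique (hxz.comp hs.tendsto_atTop) ?_
    exact tendsto_iff_norm_sub_tendsto_zero.1 hsz
  rw [hℓ] at hxz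
  exact ⟨z, hz, tendsto_iff_norm_sub_tendsto_zero.2 hxz⟩

/-- The fixed points of the forward-backward operator are the minimizers of `f + φ`. -/
theorem forwardBackward_eq_self_iff (hconv : ConvexOn ℝ Set.univ f)
    (hf : ∀ x, HasGradientAt f (F x) x) (hF : LipschitzWith L F) (hφ : GammaZero φ)
    (hγ : 0 < γ) (z : H) :
    prox γ φ (z - γ • F z) = z ↔
      φ z ≠ ⊤ ∧ ∀ x, φ x ≠ ⊤ → f z + (φ z).toReal ≤ f x + (φ x).toReal := by
  have hinner : ∀ x, ⟪z - γ • F z - z, x - z⟫_ℝ = γ * -⟪F z, x - z⟫_ℝ := by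
    intro x
    rw [sub_sub_cancel_left, inner_neg_left, real_inner_smul_left]
    ring
  constructor
  · intro hz
    have hzt := hφ.prox_ne_top hγ (z - γ • F z)
    rw [hz] at hzt
    refine ⟨hzt, fun x hx => ?_⟩
    have h₁ := hφ.inner_prox_le hγ (z - γ • F z) hx
    rw [hz, hinner] at h₁
    have h₂ := le_of_mul_le_mul_left h₁ hγ
    have h₃ := add_inner_le_of_convexOn hconv hf hF z (x - z)
    rw [add_sub_cancel] at h₃
    linarith
  · rintro ⟨hz, hmin⟩
    refine hφ.prox_eq hγ hz fun x hx => ?_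
    rw [hinner]
    refine mul_le_mul_of_nonneg_left ?_ hγ.le
    rw [← sub_nonneg]
    refine nonneg_of_forall_nonneg_add_mul (b := L / 2 * ‖x - z‖ ^ 2) fun t ht ht1 => ?_
    have hcombo := hφ.le_combo hz hx (sub_nonneg.2 ht1) ht.le (by ring)
    have hzt : (1 - t) • z + t • x = z + t • (x - z) := by module
    rw [hzt] at hcombo
    have hfin : φ (z + t • (x - z)) ≠ ⊤ := ne_top_of_le_ne_top (EReal.coe_ne_top _) hcombo
    rw [← hφ.coe_toReal hfin, EReal.coe_le_coe_iff] at hcombo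
    have h₁ := hmin _ hfin
    have h₂ := le_add_inner_add_sq_of_lipschitz hf hF z (t • (x - z))
    rw [real_inner_smul_right, norm_smul, Real.norm_eq_abs, mul_pow, sq_abs] at h₂
    refine nonneg_of_mul_nonneg_right (a := t) ?_ ht
    nlinarith

end ForwardBackward

/-! ### Solutions of the composite problem in real-valued form -/

section Solution

variable {H : Type*} [NormedAddCommGroup H] [InnerProductSpace ℝ H]
  {m : ℕ} {G : Fin m → Type*} [∀ i, NormedAddCommGroup (G i)]
  [∀ i, InnerProductSpace ℝ (G i)]
  {f : H → ℝ} {g : H → EReal} {h : ∀ i, G i → EReal} {B : ∀ i, H →L[ℝ] G i}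

theorem objective_ne_top_iff {x : H} : objective f g h B x ≠ ⊤ ↔ nonsmooth g h B x ≠ ⊤ := by
  rw [objective, EReal.add_ne_top_iff_ne_top_right (EReal.coe_ne_bot _) (EReal.coe_ne_top _)]

theorem isSolution_iff (hφ : GammaZero (nonsmooth g h B)) (z : H) :
    IsSolution f g h B z ↔ nonsmooth g h B z ≠ ⊤ ∧ ∀ x, nonsmooth g h B x ≠ ⊤ →
      f z + (nonsmooth g h B z).toReal ≤ f x + (nonsmooth g h B x).toReal := by
  have hreal : ∀ x, nonsmooth g h B x ≠ ⊤ →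
      objective f g h B x = ((f x + (nonsmooth g h B x).toReal : ℝ) : EReal) := by
    intro x hx
    rw [EReal.coe_add, hφ.coe_toReal hx, objective]
  rw [IsSolution, objective_ne_top_iff]
  refine and_congr_right fun hz => ⟨fun hmin x hx => ?_, fun hmin x => ?_⟩
  · have h₁ := hmin x
    rwa [hreal z hz, hreal x hx, EReal.coe_le_coe_iff] at h₁
  · by_cases hx : nonsmooth g h B x = ⊤
    · rw [not_not.1 (mt objective_ne_top_iff.1 (not_not.2 hx))]
      exact le_top
    · rw [hreal z hz, hreal x hx, EReal.coe_le_coe_iff]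
      exact hmin x hx

end Solution

end CompositeSplitting

end

/-! ### Convergence of the nested algorithm -/

theorem theorem4p1
    {H : Type*} [NormedAddCommGroup H] [InnerProductSpace ℝ H] [CompleteSpace H]
    [FiniteDimensional ℝ H]
    {m : ℕ} {G : Fin m → Type*} [∀ i, NormedAddCommGroup (G i)]
    [∀ i, InnerProductSpace ℝ (G i)] [∀ i, CompleteSpace (G i)]
    [∀ i, FiniteDimensional ℝ (G i)]
    (f : H → ℝ) (g : H → EReal) (h : ∀ i, G i → EReal) (B : ∀ i, H →L[ℝ] G i)
    (L : ℝ≥0) (hL : 0 < L)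
    (hf_conv : ConvexOn ℝ Set.univ f) (hf_diff : Differentiable ℝ f)
    (hf_lip : LipschitzWith L (∇ f))
    (hg : CompositeSplitting.GammaZero g)
    (hh : ∀ i, CompositeSplitting.GammaZero (h i))
    (hsol : ∃ z, CompositeSplitting.IsSolution f g h B z)
    (w : Fin m → ℝ) (hw_pos : ∀ i, 0 < w i) (hw_sum : ∑ i, w i = 1)
    (γ : ℝ) (hγ_pos : 0 < γ) (hγ_lt : γ < 2 / (L : ℝ))
    (lam : ℝ) (hlam_pos : 0 < lam) (hlam_lt : lam * ∑ i, w i * ‖B i‖ ^ 2 < 2)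
    (ε : ℕ → ℝ) (hε : Summable ε)
    (x0 : H) (y0 : ∀ i, G i)
    (x u : ℕ → H) (y : ℕ → ℕ → ∀ i, G i)
    (hgen : CompositeSplitting.IsGenerated f g h B w γ lam ε x0 y0 x u y) :
    (∀ k, Tendsto (fun j => CompositeSplitting.primalPoint g B w γ (u k) (y k j)) atTop
      (𝓝 (CompositeSplitting.prox γ (CompositeSplitting.nonsmooth g h B) (u k)))) ∧
    ∃ z, CompositeSplitting.IsSolution f g h B z ∧ Tendsto x atTop (𝓝 z) := by
  have hdom : ∃ z, CompositeSplitting.nonsmooth g h B z ≠ ⊤ := by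
    obtain ⟨z, hz, -⟩ := hsol
    exact ⟨z, CompositeSplitting.objective_ne_top_iff.1 hz⟩
  have hφ := CompositeSplitting.gammaZero_nonsmooth B hg hh hdom
  have hinner : ∀ k, Tendsto (fun j => CompositeSplitting.primalPoint g B w γ (u k) (y k j)) atTop
      (𝓝 (CompositeSplitting.prox γ (CompositeSplitting.nonsmooth g h B) (u k))) := fun k =>
    CompositeSplitting.tendsto_primalPoint hg hh hdom hw_pos hγ_pos hlam_pos hlam_lt
      (hgen.inner k)
  refine ⟨hinner, ?_⟩
  have hgrad : ∀ x, HasGradientAt f (∇ f x) x := fun x => (hf_diff x).hasGradientAt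
  have hfix : ∀ z, CompositeSplitting.prox γ (CompositeSplitting.nonsmooth g h B)
      (z - γ • ∇ f z) = z ↔ CompositeSplitting.IsSolution f g h B z := fun z => by
    rw [CompositeSplitting.isSolution_iff hφ,
      CompositeSplitting.forwardBackward_eq_self_iff hf_conv hgrad hf_lip hφ hγ_pos]
  -- The absolute value is needed because `ε k` may be negative when the loop is carried to its
  -- limit; that loop has zero error.
  have herr : ∀ k, ‖x (k + 1) - CompositeSplitting.prox γ (CompositeSplitting.nonsmooth g h B)
      (x k - γ • ∇ f (x k))‖ ≤ |ε k| := by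
    intro k
    rw [← hgen.outer k]
    rcases hgen.update k with hlim | ⟨J, -, hle⟩
    · rw [tendsto_nhds_unique hlim (hinner k), sub_self, norm_zero]
      exact abs_nonneg _
    · exact hle.trans (le_abs_self _)
  obtain ⟨z, hz, hxz⟩ := CompositeSplitting.exists_tendsto_forwardBackward hL hf_conv hgrad hf_lip
    hφ hγ_pos hγ_lt (by obtain ⟨z, hz⟩ := hsol; exact ⟨z, (hfix z).2 hz⟩) hε.abs herr
  exact ⟨z, (hfix z).1 hz, hxz⟩
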